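/- Let $\mathbb T=\mathbb R/2\pi\mathbb Z$, and let $\sigma\in L^\infty(\mathbb T)$ be real with $\operatorname{ess\,inf}\sigma>0$. For $h\in L^2(\mathbb T)$ write $h_{\rm avg}=\frac1{2\pi}\int_0^{2\pi}h\,dx$ and $\|h\|^2=\frac1{2\pi}\int_0^{2\pi}|h|^2\,dx$; for a pair put $\|(f_+,f_-)\|^2=\|f_+\|^2+\|f_-\|^2$. For real $f,g\in L^2(\mathbb T)$ and $\theta>0$ let $$E_\theta(f,g)=\|f\|^2+\|g\|^2-\frac{\theta}{2\pi}\int_0^{2\pi}\partial_x^{-1}f(x)\,g(x)\,dx,\qquad \partial_x^{-1}f(x)=\int_0^xf(y)\,dy-\Big(\int_0^xf(y)\,dy\Big)_{\rm avg}.$$ Let $u,v\in C([0,\infty);L^2(\mathbb T))$ be a real valued mild solution of $$\partial_tu+\partial_xv=0,\qquad \partial_tv+\partial_xu=-\sigma v,\qquad u(0)=u_0,\quad v(0)=v_0,$$ with $u_0,v_0\in L^2(\mathbb T)$; that is, $w=(u,v)$ satisfies the variation of constants formula $w(t)=T(t)w(0)+\int_0^tT(t-s)\,(0,-\sigma v(s))\,ds$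 for all $t\ge0$, where $T$ is the $C_0$-group generated on $L^2(\mathbb T)^2$ by $(u,v)\mapsto(-\partial_xv,-\partial_xu)$. Put $u_{\rm avg}=(u_0)_{\rm avg}$, $f_\pm=\frac{u\pm v}2$, $f(t)=(f_+(t),f_-(t))$, $f_0=\big(\frac{u_0+v_0}2,\frac{u_0-v_0}2\big)$ and $f_\infty=\frac{u_{\rm avg}}2$. Then the following holds for all $t\ge0$. (a) Let $\sigma(x)=\sigma>0$ be constant. If $\sigma\ne2$, let $\theta(\sigma)=\sigma$, $\mu(\sigma)=\frac\sigma2$, $C_\sigma=\sqrt{\frac{2+\sigma}{2-\sigma}}$ for $0<\sigma<2$, and $\theta(\sigma)=\frac4\sigma$, $\mu(\sigma)=\frac\sigma2-\sqrt{\frac{\sigma^2}4-1}$, $C_\sigma=\sqrt{\frac{\sigma+2}{\sigma-2}}$ for $\sigma>2$. Then $$E_{\theta(\sigma)}(u(t)-u_{\rm avg},v(t))\le E_{\theta(\sigma)}(u_0-u_{\rm avg},v_0)\,e^{-2\mu(\sigma)t},$$ $$\Big\|f(t)-\tbinom{f_\infty}{f_\infty}\Big\|\le C_\sigma\Big\|f_0-\tbinom{f_\infty}{f_\infty}\Big\|e^{-\mu(\sigma)t},$$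 and the rate $\mu(\sigma)$ is sharp: there are a real mild solution and a constant $c>0$ with $\big\|f(t)-\binom{f_\infty}{f_\infty}\big\|\ge c\,e^{-\mu(\sigma)t}$ for all $t\ge0$. If $\sigma=2$, then for every $0<\epsilon<1$, with $\theta_\epsilon=\frac{2(2-\epsilon^2)}{2+\epsilon^2}$, $$E_{\theta_\epsilon}(u(t)-u_{\rm avg},v(t))\le E_{\theta_\epsilon}(u_0-u_{\rm avg},v_0)\,e^{-2(1-\epsilon)t},\qquad \Big\|f(t)-\tbinom{f_\infty}{f_\infty}\Big\|\le\frac{\sqrt2}\epsilon\Big\|f_0-\tbinom{f_\infty}{f_\infty}\Big\|e^{-(1-\epsilon)t}.$$ (b) Let $\sigma$ be non-constant, with $\sigma_{\min}:=\operatorname{ess\,inf}\sigma$ and $\sigma_{\max}:=\operatorname{ess\,sup}\sigma$, so that $0<\sigma_{\min}<\sigma_{\max}<\infty$. Let $\theta^*=\min(\sigma_{\min},\frac4{\sigma_{\max}})$ and $$\alpha^*=\begin{cases}\dfrac{\sigma_{\min}\big(4+2\sqrt{4-\sigma_{\min}^2}-\sigma_{\min}\sigma_{\max}\big)}{4+2\sqrt{4-\sigma_{\min}^2}-\sigma_{\min}^2},&\sigma_{\min}<\frac4{\sigma_{\max}},\\[2mm]\sigma_{\max}-\sqrt{\sigma_{\max}^2-4},&\sigma_{\min}\ge\frac4{\sigma_{\max}}.\end{cases}$$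 Then $$E_{\theta^*}(u(t)-u_{\rm avg},v(t))\le E_{\theta^*}(u_0-u_{\rm avg},v_0)\,e^{-\alpha^*t},\qquad \Big\|f(t)-\tbinom{f_\infty}{f_\infty}\Big\|\le\sqrt{\frac{2+\theta^*}{2-\theta^*}}\,\Big\|f_0-\tbinom{f_\infty}{f_\infty}\Big\|e^{-\frac{\alpha^*}2t}.$$ -/

import Mathlib

open MeasureTheory Real
open scoped ENNReal

noncomputable section

namespace GoldsteinTaylor

instance factTwoPiPos : Fact (0 < 2 * π) := ⟨Real.two_pi_pos⟩

/-- The torus `𝕋 = ℝ / 2πℤ`. -/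
abbrev Torus : Type := AddCircle (2 * π)

/-- The normalized Lebesgue measure `dx / 2π` on the torus. -/
abbrev torusMeasure : Measure Torus := AddCircle.haarAddCircle

/-- The real space `L²(𝕋)`, with the inner product `(1/2π) ∫₀^{2π} f g dx`. -/
abbrev L2 : Type := Lp ℝ 2 torusMeasure

/-- The real space `L^∞(𝕋)`. -/
abbrev LInfty : Type := Lp ℝ ∞ torusMeasure

/-- The constant function `c` as an element of `L²(𝕋)`. -/
def constL2 (c : ℝ) : L2 := Lp.const 2 torusMeasure c

/-- The average `h_avg = (1/2π) ∫₀^{2π} h(x) dx` of a function on `[0, 2π]`. -/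
def avg (h : ℝ → ℝ) : ℝ := (1 / (2 * π)) * ∫ x in (0 : ℝ)..(2 * π), h x

/-- A function on the torus, read as a function of `x ∈ ℝ`. -/
def lift (f : L2) (x : ℝ) : ℝ := f (x : Torus)

/-- The average of an element of `L²(𝕋)`. -/
def avgL2 (f : L2) : ℝ := avg (lift f)

/-- The anti-derivative
`∂ₓ⁻¹ f (x) = ∫₀ˣ f(y) dy - (∫₀ˣ f(y) dy)_avg`, for `x ∈ [0, 2π]`. -/
def antideriv (f : L2) (x : ℝ) : ℝ :=
  (∫ y in (0 : ℝ)..x, lift f y) - avg (fun z => ∫ y in (0 : ℝ)..z, lift f y)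

/-- The entropy
`E_θ(f, g) = ‖f‖² + ‖g‖² - (θ/2π) ∫₀^{2π} ∂ₓ⁻¹f(x) g(x) dx` of two real functions. -/
def entropy (θ : ℝ) (f g : L2) : ℝ :=
  ‖f‖ ^ 2 + ‖g‖ ^ 2
    - (θ / (2 * π)) * ∫ x in (0 : ℝ)..(2 * π), antideriv f x * lift g x

/-- The translation `h ↦ h(· - t)` on `L²(𝕋)`. -/
def translate (t : ℝ) (h : L2) : L2 :=
  Lp.compMeasurePreserving (fun x : Torus => x - (t : Torus))
    (measurePreserving_sub_right torusMeasure (t : Torus)) h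

/-- The `C₀`-group on `L²(𝕋) × L²(𝕋)` generated by the free transport operator
`(u, v) ↦ (-∂ₓ v, -∂ₓ u)`: the combination `u + v` is transported with velocity `1`
and `u - v` with velocity `-1`. -/
def freeFlow (t : ℝ) (w : L2 × L2) : L2 × L2 :=
  ((2⁻¹ : ℝ) • (translate t (w.1 + w.2) + translate (-t) (w.1 - w.2)),
   (2⁻¹ : ℝ) • (translate t (w.1 + w.2) - translate (-t) (w.1 - w.2)))

/-- The bounded relaxation operator `(u, v) ↦ (0, -σ v)` on `L²(𝕋) × L²(𝕋)`. -/
def relaxation (σ : LInfty) (w : L2 × L2) : L2 × L2 :=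
  (0, -(σ • w.2 : L2))

/-- `(u, v)`, with `u, v ∈ C([0, ∞); L²(𝕋))`, is the mild solution of
`∂ₜ u + ∂ₓ v = 0`, `∂ₜ v + ∂ₓ u = -σ v` with initial datum `(u₀, v₀)`:
the variation of constants formula
`w(t) = T(t) w₀ + ∫₀ᵗ T(t - s) B w(s) ds` holds in `L²(𝕋) × L²(𝕋)` for every `t ≥ 0`, where
`T` is the transport group, `B` the relaxation operator and `w = (u, v)`. -/
structure IsMildSolution (σ : LInfty) (u₀ v₀ : L2) (u v : ℝ → L2) : Prop where
  continuousOn_u : ContinuousOn u (Set.Ici 0)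
  continuousOn_v : ContinuousOn v (Set.Ici 0)
  duhamel : ∀ t : ℝ, 0 ≤ t →
    (u t, v t) = freeFlow t (u₀, v₀)
      + ∫ s in (0 : ℝ)..t, freeFlow (t - s) (relaxation σ (u s, v s))

/-- The norm `‖f - (f_∞, f_∞)ᵀ‖` in `L²(𝕋)²`, where `f = (f₊, f₋)ᵀ`, `f₊ = (u + v)/2` and
`f₋ = (u - v)/2`. -/
def distEquilibrium (finf : ℝ) (u v : L2) : ℝ :=
  ‖WithLp.toLp 2 ((2⁻¹ : ℝ) • (u + v) - constL2 finf, (2⁻¹ : ℝ) • (u - v) - constL2 finf)‖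

/-- `θ(σ)` for constant `σ ≠ 2`. -/
def thetaConst (σ : ℝ) : ℝ := if σ < 2 then σ else 4 / σ

/-- `μ(σ)` for constant `σ ≠ 2`. -/
def muConst (σ : ℝ) : ℝ := if σ < 2 then σ / 2 else σ / 2 - √(σ ^ 2 / 4 - 1)

/-- `C_σ` for constant `σ ≠ 2`. -/
def CConst (σ : ℝ) : ℝ :=
  if σ < 2 then √((2 + σ) / (2 - σ)) else √((σ + 2) / (σ - 2))

/-- The parameter of the entropy in the case `σ = 2`. -/
def thetaEps (ε : ℝ) : ℝ := 2 * (2 - ε ^ 2) / (2 + ε ^ 2)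

/-- `θ* = min(σ_min, 4 / σ_max)`. -/
def thetaStar (smin smax : ℝ) : ℝ := min smin (4 / smax)

/-- The decay rate `α*(σ_min, σ_max)`. -/
def alphaStar (smin smax : ℝ) : ℝ :=
  if smin < 4 / smax then
    smin * (4 + 2 * √(4 - smin ^ 2) - smin * smax) / (4 + 2 * √(4 - smin ^ 2) - smin ^ 2)
  else smax - √(smax ^ 2 - 4)

/-- The essential infimum of `σ` on the torus. -/
def sigmaMin (σ : LInfty) : ℝ := essInf (σ : Torus → ℝ) torusMeasure

/-- The essential supremum of `σ` on the torus. -/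
def sigmaMax (σ : LInfty) : ℝ := essSup (σ : Torus → ℝ) torusMeasure

end GoldsteinTaylor

end

/-! Write `J` for `antiderivOp`. Formally, along a solution, the entropy `E` satisfies `-E' - αE =
(θ-α)‖u - u_avg‖² + θ (v_avg)²` plus the integral of `(2σ-θ-α) v² - θ(σ-α) (J u) v`. On the circle
`‖J u‖ ≤ ‖u - u_avg‖`, so for `α ≤ θ` the term `‖u - u_avg‖²` may be replaced by `‖J u‖²`. What
remains is a quadratic form in the values of `(J u, v)` at each point, and its discriminant
condition is `RateCondition θ α (σ x)`. This gives `entropy_decay`. Since `|⟪J f, g⟫| ≤ (‖f‖² +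
‖g‖²)/2`, the entropy is comparable to the squared distance with factors `2 ± θ`, which gives
`dist_decay`.

A mild solution is only continuous in time, so `E` cannot be differentiated naively. The profiles of
`u ± v` along characteristics are differentiable in `L²`, their derivatives containing only `σ v`.
In terms of them the transport enters `E` only through a translation applied to `J` of a profile,
and translation is differentiable on the range of `J` (`hasDerivAt_translate_antiderivOp`).

The rest is algebra. The discriminant is concave in `σ(x)`, so the condition need only be checked at
two endpoints (`RateCondition.of_endpoints`, `rateCondition_star`). Sharpness comes from the Fourier
mode `(a(t) cos x, b(t) sin x)`, which reduces the system to a 2×2 linear ODE. -/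

namespace GoldsteinTaylor

open Filter Topology
open scoped RealInnerProductSpace

/-! ### Translations on `L²` as a strongly continuous group of isometries. -/

section Translation

theorem measurePreserving_sub_coe (t : ℝ) :
    MeasurePreserving (fun x : Torus => x - (t : Torus)) torusMeasure torusMeasure :=
  measurePreserving_sub_right torusMeasure (t : Torus)

/-- The translation by `t` as a linear isometry. -/
noncomputable def translateIsometry (t : ℝ) : L2 →ₗᵢ[ℝ] L2 :=
  Lp.compMeasurePreservingₗᵢ ℝ _ (measurePreserving_sub_coe t)

theorem translate_add (t : ℝ) (f g : L2) :
    translate t (f + g) = translate t f + translate t g := map_add (translateIsometry t) f g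

theorem translate_sub (t : ℝ) (f g : L2) :
    translate t (f - g) = translate t f - translate t g := map_sub (translateIsometry t) f g

theorem translate_neg (t : ℝ) (f : L2) :
    translate t (-f) = -translate t f := map_neg (translateIsometry t) f

theorem translate_smul (t c : ℝ) (f : L2) :
    translate t (c • f) = c • translate t f := map_smul (translateIsometry t) c f

theorem norm_translate (t : ℝ) (f : L2) : ‖translate t f‖ = ‖f‖ := (translateIsometry t).norm_map f

theorem inner_translate_translate (t : ℝ) (f g : L2) :
    ⟪translate t f, translate t g⟫ = ⟪f, g⟫ := (translateIsometry t).inner_map_map f g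

theorem coeFn_translate (t : ℝ) (f : L2) :
    (translate t f : Torus → ℝ) =ᵐ[torusMeasure] fun x => f (x - (t : Torus)) :=
  Lp.coeFn_compMeasurePreserving f (measurePreserving_sub_coe t)

theorem translate_translate (s t : ℝ) (f : L2) :
    translate s (translate t f) = translate (t + s) f := by
  refine Lp.ext ?_
  filter_upwards [coeFn_translate s (translate t f), coeFn_translate (t + s) f,
    (measurePreserving_sub_coe s).quasiMeasurePreserving.ae (coeFn_translate t f)] with x h1 h2 h3
  rw [h1, h2, h3, AddCircle.coe_add, sub_sub, add_comm]

theorem translate_zero (f : L2) : translate 0 f = f := by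
  refine Lp.ext ?_
  filter_upwards [coeFn_translate 0 f] with x h
  simp [h]

theorem translate_two_pi_add (t : ℝ) (f : L2) : translate (t + 2 * π) f = translate t f := by
  refine Lp.ext ?_
  filter_upwards [coeFn_translate t f, coeFn_translate (t + 2 * π) f] with x h1 h2
  rw [h1, h2, AddCircle.coe_add_period]

theorem inner_translate_left (t : ℝ) (f g : L2) :
    ⟪translate t f, g⟫ = ⟪f, translate (-t) g⟫ := by
  rw [← inner_translate_translate (-t) (translate t f) g, translate_translate, add_neg_cancel,
    translate_zero]

/-- Translation is strongly continuous but not norm continuous in the shift, so continuity is stated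
jointly in the shift and the vector; the Bochner integrals and the product rule below rest on it. -/
theorem continuous_translate_comp {X : Type*} [TopologicalSpace X] {a : X → ℝ} {f : X → L2}
    (ha : Continuous a) (hf : Continuous f) : Continuous fun x => translate (a x) (f x) := by
  have hF : Continuous (Function.uncurry fun (x : X) (y : Torus) => y - ((a x : ℝ) : Torus)) :=
    continuous_snd.sub ((AddCircle.continuous_mk' (2 * π)).comp (ha.comp continuous_fst))
  let G : C(X, C(Torus, Torus)) := ContinuousMap.curry ⟨_, hF⟩
  exact hf.compMeasurePreservingLp (g := fun x => G x) G.continuous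
    (fun x => measurePreserving_sub_coe (a x)) (by simp)

theorem continuous_translate (f : L2) : Continuous fun t => translate t f :=
  continuous_translate_comp continuous_id continuous_const

end Translation

/-! ### Fourier coefficients, Parseval, and translation invariant functions. -/

section FourierCoefficients

/-- The `k`-th complex Fourier coefficient of a real function on the torus. -/
noncomputable def coef (k : ℤ) : L2 →L[ℝ] ℂ :=
  ((innerSL ℂ (fourierLp (T := 2 * π) 2 k)).restrictScalars ℝ).comp
    (Complex.ofRealCLM.compLpL 2 torusMeasure)

theorem coef_eq_fourierCoeff (k : ℤ) (f : L2) :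
    coef k f = fourierCoeff (fun x : Torus => (f x : ℂ)) k := by
  have h : coef k f = inner ℂ (fourierLp (T := 2 * π) 2 k) (Complex.ofRealCLM.compLp f) := rfl
  rw [h, ← coe_fourierBasis, ← HilbertBasis.repr_apply_apply, fourierBasis_repr]
  exact congrFun (fourierCoeff_congr_ae (ContinuousLinearMap.coeFn_compLp Complex.ofRealCLM f)) k

theorem hasSum_sq_coef (f : L2) : HasSum (fun k => ‖coef k f‖ ^ 2) (‖f‖ ^ 2) := by
  have h := hasSum_sq_fourierCoeff (Complex.ofRealCLM.compLp f : Lp ℂ 2 torusMeasure)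
  have h2 : ∫ t : Torus, ‖(Complex.ofRealCLM.compLp f : Lp ℂ 2 torusMeasure) t‖ ^ 2 ∂torusMeasure
      = ‖f‖ ^ 2 := by
    rw [← real_inner_self_eq_norm_sq, L2.inner_def]
    refine integral_congr_ae ?_
    filter_upwards [ContinuousLinearMap.coeFn_compLp Complex.ofRealCLM f] with x hx
    rw [hx]
    simp [sq]
  rw [h2] at h
  rw [fourierCoeff_congr_ae (ContinuousLinearMap.coeFn_compLp Complex.ofRealCLM f)] at h
  simp only [coef_eq_fourierCoeff]
  exact h

theorem ext_coef {f g : L2} (h : ∀ k, coef k f = coef k g) : f = g := by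
  have h1 := hasSum_sq_coef (f - g)
  simp only [map_sub, h, sub_self, norm_zero, ne_eq, OfNat.ofNat_ne_zero, not_false_eq_true,
    zero_pow] at h1
  have h2 := h1.unique hasSum_zero
  exact sub_eq_zero.1 (norm_eq_zero.1 (pow_eq_zero_iff two_ne_zero |>.1 h2))

theorem coef_translate (k : ℤ) (t : ℝ) (f : L2) :
    coef k (translate t f) = fourier (-k) (t : Torus) * coef k f := by
  rw [coef_eq_fourierCoeff, coef_eq_fourierCoeff, fourierCoeff, fourierCoeff,
    ← integral_const_mul]
  rw [← integral_sub_right_eq_self (μ := torusMeasure)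
    (fun x : Torus => fourier (-k) (t : Torus) * fourier (-k) x • (f x : ℂ)) (t : Torus)]
  refine integral_congr_ae ?_
  filter_upwards [coeFn_translate t f] with x hx
  rw [hx, smul_eq_mul, smul_eq_mul, ← mul_assoc]
  congr 1
  simp only [fourier_apply]
  rw [← Circle.coe_mul, ← AddCircle.toCircle_add, ← smul_add, add_sub_cancel]

theorem integral_haar_eq_interval {E : Type*} [NormedAddCommGroup E] [NormedSpace ℝ E]
    (f : Torus → E) :
    ∫ x, f x ∂torusMeasure = (1 / (2 * π)) • ∫ x in (0 : ℝ)..(2 * π), f (x : Torus) := by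
  rw [AddCircle.integral_haarAddCircle, ← AddCircle.intervalIntegral_preimage (2 * π) 0, zero_add,
    one_div]

theorem coef_eq_intervalIntegral (k : ℤ) (f : L2) :
    coef k f = (1 / (2 * π)) •
      ∫ x in (0 : ℝ)..(2 * π), fourier (-k) (x : Torus) * (lift f x : ℂ) := by
  rw [coef_eq_fourierCoeff, fourierCoeff, integral_haar_eq_interval]
  rfl

theorem coef_zero (f : L2) : coef 0 f = (avgL2 f : ℂ) := by
  rw [coef_eq_intervalIntegral, avgL2, avg]
  simp [intervalIntegral.integral_ofReal]

theorem coeFn_constL2 (c : ℝ) : (constL2 c : Torus → ℝ) =ᵐ[torusMeasure] fun _ => c :=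
  Lp.coeFn_const _ _ _

theorem translate_constL2 (t c : ℝ) : translate t (constL2 c) = constL2 c := by
  refine Lp.ext ?_
  filter_upwards [coeFn_translate t (constL2 c), coeFn_constL2 c,
    (measurePreserving_sub_coe t).quasiMeasurePreserving.ae (coeFn_constL2 c)] with x h1 h2 h3
  rw [h1, h2, h3]

theorem exists_fourier_ne_one {k : ℤ} (hk : k ≠ 0) :
    ∃ t : ℝ, fourier (-k) (t : Torus) ≠ 1 := by
  -- At this shift the character takes the value `exp(-iπ) = -1`.
  refine ⟨π / k, ?_⟩
  rw [fourier_coe_apply]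
  have hk' : (k : ℂ) ≠ 0 := by exact_mod_cast hk
  have hpi : (π : ℂ) ≠ 0 := by exact_mod_cast Real.pi_ne_zero
  have : (2 * (π : ℂ) * Complex.I * ((-k : ℤ) : ℂ) * ((π / k : ℝ) : ℂ) / ((2 * π : ℝ) : ℂ))
      = -(π * Complex.I) := by
    push_cast
    field_simp
  rw [this, Complex.exp_neg, Complex.exp_pi_mul_I]
  norm_num

theorem coef_eq_zero_of_translate {f : L2} (hf : ∀ t, translate t f = f) {k : ℤ} (hk : k ≠ 0) :
    coef k f = 0 := by
  obtain ⟨t, ht⟩ := exists_fourier_ne_one hk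
  have h := coef_translate k t f
  rw [hf] at h
  have h' : (1 - fourier (-k) (t : Torus)) * coef k f = 0 := by linear_combination h
  exact (mul_eq_zero.1 h').resolve_left (sub_ne_zero.2 ht.symm)

theorem avgL2_constL2 (c : ℝ) : avgL2 (constL2 c) = c := by
  have h : avgL2 (constL2 c) = ∫ x, (constL2 c : Torus → ℝ) x ∂torusMeasure := by
    rw [integral_haar_eq_interval]; rfl
  rw [h, integral_congr_ae (coeFn_constL2 c)]
  simp

theorem eq_constL2_of_translate {f : L2} (hf : ∀ t, translate t f = f) :
    f = constL2 (avgL2 f) := by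
  refine ext_coef fun k => ?_
  by_cases hk : k = 0
  · subst hk
    rw [coef_zero, coef_zero, avgL2_constL2]
  · rw [coef_eq_zero_of_translate hf hk,
      coef_eq_zero_of_translate (fun t => translate_constL2 t _) hk]

theorem inner_constL2_left (c : ℝ) (f : L2) : ⟪constL2 c, f⟫ = c * avgL2 f := by
  have h : avgL2 f = ∫ x, (f : Torus → ℝ) x ∂torusMeasure := by
    rw [integral_haar_eq_interval]; rfl
  rw [L2.inner_def, h, ← integral_const_mul]
  refine integral_congr_ae ?_
  filter_upwards [coeFn_constL2 c] with x hx
  rw [hx]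
  simp [mul_comm]

theorem avgL2_eq_inner (f : L2) : avgL2 f = ⟪constL2 1, f⟫ := by
  rw [inner_constL2_left, one_mul]

end FourierCoefficients

/-! ### The zero-average antiderivative as an operator on `L²`. -/

section Antiderivative

theorem translate_intervalIntegral (h a b : ℝ) {F : ℝ → L2} (hF : Continuous F) :
    translate h (∫ r in a..b, F r) = ∫ r in a..b, translate h (F r) :=
  ((translateIsometry h).toContinuousLinearMap.intervalIntegral_comp_comm
    (hF.intervalIntegrable a b)).symm

theorem inner_intervalIntegral_left (g : L2) (a b : ℝ) {F : ℝ → L2} (hF : Continuous F) :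
    ⟪∫ r in a..b, F r, g⟫ = ∫ r in a..b, ⟪F r, g⟫ := by
  rw [real_inner_comm]
  simp_rw [real_inner_comm g]
  exact ((innerSL ℝ g).intervalIntegral_comp_comm (hF.intervalIntegrable a b)).symm

theorem inner_intervalIntegral_right (g : L2) (a b : ℝ) {F : ℝ → L2} (hF : Continuous F) :
    ⟪g, ∫ r in a..b, F r⟫ = ∫ r in a..b, ⟪g, F r⟫ :=
  ((innerSL ℝ g).intervalIntegral_comp_comm (hF.intervalIntegrable a b)).symm

theorem integral_translate_period (f : L2) (h : ℝ) :
    ∫ r in h..h + 2 * π, translate r f = ∫ r in (0 : ℝ)..2 * π, translate r f := by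
  have hp : Function.Periodic (fun r => translate r f) (2 * π) := fun r => translate_two_pi_add r f
  simpa using hp.intervalIntegral_add_eq h 0

/-- Shifting an integral over a full period changes nothing, so the result is translation invariant,
hence constant, and its average identifies the constant. -/
theorem integral_translate (f : L2) :
    ∫ r in (0 : ℝ)..2 * π, translate r f = (2 * π) • constL2 (avgL2 f) := by
  have hinv : ∀ t, translate t (∫ r in (0 : ℝ)..2 * π, translate r f)
      = ∫ r in (0 : ℝ)..2 * π, translate r f := by
    intro t
    rw [translate_intervalIntegral _ _ _ (continuous_translate f)]
    simp_rw [translate_translate]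
    rw [intervalIntegral.integral_comp_add_right (fun r => translate r f), zero_add, add_comm,
      integral_translate_period]
  rw [eq_constL2_of_translate hinv]
  have h : avgL2 (∫ r in (0 : ℝ)..2 * π, translate r f) = (2 * π) * avgL2 f := by
    rw [avgL2_eq_inner, inner_intervalIntegral_right _ _ _ (continuous_translate f)]
    have : ∀ r, ⟪constL2 1, translate r f⟫ = avgL2 f := by
      intro r
      rw [← translate_constL2 r, inner_translate_translate, ← avgL2_eq_inner]
    simp [this]
  rw [h]
  exact map_smul (Lp.constₗ 2 torusMeasure ℝ) (2 * π) (avgL2 f)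

theorem continuous_sawtooth_translate (f : L2) :
    Continuous fun r => (π - r) • translate r f :=
  (continuous_const.sub continuous_id).smul (continuous_translate f)

/-- The anti-derivative with zero average of `f - f_avg`, as a convolution with the sawtooth. -/
noncomputable def antiderivOp : L2 →L[ℝ] L2 :=
  LinearMap.mkContinuous
    { toFun := fun f => (1 / (2 * π)) • ∫ r in (0 : ℝ)..2 * π, (π - r) • translate r f
      map_add' := by
        intro f g
        simp_rw [translate_add, smul_add]
        rw [intervalIntegral.integral_add
          ((continuous_sawtooth_translate f).intervalIntegrable _ _)
          ((continuous_sawtooth_translate g).intervalIntegrable _ _), smul_add]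
      map_smul' := by
        intro c f
        simp_rw [translate_smul, smul_comm _ c]
        rw [intervalIntegral.integral_smul, smul_comm _ c, RingHom.id_apply] }
    π (by
      intro f
      have h : ‖∫ r in (0 : ℝ)..2 * π, (π - r) • translate r f‖
          ≤ (π * ‖f‖) * |2 * π - 0| := by
        refine intervalIntegral.norm_integral_le_of_norm_le_const fun r hr => ?_
        rw [Set.uIoc_of_le Real.two_pi_pos.le] at hr
        rw [norm_smul, norm_translate]
        gcongr
        rw [Real.norm_eq_abs, abs_le]
        constructor <;> linarith [hr.1, hr.2]
      rw [sub_zero, abs_of_pos Real.two_pi_pos] at h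
      change ‖(1 / (2 * π)) • ∫ r in (0 : ℝ)..2 * π, (π - r) • translate r f‖ ≤ _
      rw [norm_smul, Real.norm_of_nonneg (by positivity)]
      calc 1 / (2 * π) * ‖∫ r in (0 : ℝ)..2 * π, (π - r) • translate r f‖
          ≤ 1 / (2 * π) * (π * ‖f‖ * (2 * π)) := by gcongr
        _ = π * ‖f‖ := by field_simp)

theorem antiderivOp_apply (f : L2) :
    antiderivOp f = (1 / (2 * π)) • ∫ r in (0 : ℝ)..2 * π, (π - r) • translate r f := rfl

theorem translate_antiderivOp (h : ℝ) (f : L2) :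
    translate h (antiderivOp f) = antiderivOp (translate h f) := by
  rw [antiderivOp_apply, antiderivOp_apply, translate_smul,
    translate_intervalIntegral _ _ _ (continuous_sawtooth_translate f)]
  simp_rw [translate_smul, translate_translate, add_comm]

theorem antiderivOp_constL2 (c : ℝ) : antiderivOp (constL2 c) = 0 := by
  rw [antiderivOp_apply]
  simp_rw [translate_constL2]
  rw [intervalIntegral.integral_smul_const]
  have : ∫ r in (0 : ℝ)..2 * π, (π - r) = 0 := by
    rw [intervalIntegral.integral_sub (by simp) (by simp)]
    simp
    ring
  rw [this, zero_smul, smul_zero]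

/-- The substitution `r ↦ 2π - r` flips the sign of the sawtooth and, by periodicity, turns each
translation into its adjoint. -/
theorem inner_antiderivOp_left (f g : L2) : ⟪antiderivOp f, g⟫ = -⟪f, antiderivOp g⟫ := by
  rw [antiderivOp_apply, antiderivOp_apply, real_inner_smul_left, real_inner_smul_right,
    inner_intervalIntegral_left _ _ _ (continuous_sawtooth_translate f),
    inner_intervalIntegral_right _ _ _ (continuous_sawtooth_translate g), ← mul_neg,
    ← intervalIntegral.integral_neg]
  congr 1
  have h := intervalIntegral.integral_comp_sub_left
    (fun r => ⟪(π - r) • translate r f, g⟫) (a := 0) (b := 2 * π) (2 * π)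
  simp only [sub_self, sub_zero] at h
  rw [← h]
  refine intervalIntegral.integral_congr fun r _ => ?_
  simp only [real_inner_smul_left, real_inner_smul_right]
  rw [inner_translate_left, neg_sub, ← translate_two_pi_add (r - 2 * π), sub_add_cancel]
  ring

theorem inner_antiderivOp_self (f : L2) : ⟪antiderivOp f, f⟫ = 0 := by
  have h := inner_antiderivOp_left f f
  rw [real_inner_comm] at h ⊢
  linarith

/-- Substituting `r + h` for `r` moves `h` from the translated function to the endpoints and a
scalar factor, so the fundamental theorem of calculus can differentiate in `h` although `f` is
merely in `L²`. -/
theorem translate_antiderivOp_eq (h : ℝ) (f : L2) :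
    translate h (antiderivOp f) = (π + h) • constL2 (avgL2 f)
      - (1 / (2 * π)) • ∫ r in h..h + 2 * π, r • translate r f := by
  have hc : Continuous fun r => r • translate r f := continuous_id.smul (continuous_translate f)
  have hc' : Continuous fun r => (π + h) • translate r f :=
    (continuous_const_smul (π + h)).comp (continuous_translate f)
  have h1 : translate h (antiderivOp f)
      = (1 / (2 * π)) • ∫ r in (0 : ℝ)..2 * π, ((π + h) - (r + h)) • translate (r + h) f := by
    rw [antiderivOp_apply, translate_smul,
      translate_intervalIntegral _ _ _ (continuous_sawtooth_translate f)]
    simp_rw [translate_smul, translate_translate, add_sub_add_right_eq_sub]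
  rw [h1, intervalIntegral.integral_comp_add_right (fun r => ((π + h) - r) • translate r f),
    zero_add, add_comm (2 * π) h]
  simp_rw [sub_smul]
  rw [intervalIntegral.integral_sub
    (hc'.intervalIntegrable _ _)
    (hc.intervalIntegrable _ _), intervalIntegral.integral_smul, integral_translate_period,
    integral_translate, smul_sub, smul_smul, smul_smul]
  congr 2
  field_simp

theorem hasDerivAt_translate_antiderivOp (f : L2) (h : ℝ) :
    HasDerivAt (fun t => translate t (antiderivOp f)) (constL2 (avgL2 f) - translate h f) h := by
  have hc : Continuous fun r => r • translate r f := continuous_id.smul (continuous_translate f)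
  have hsplit : (fun t => translate t (antiderivOp f)) = fun t =>
      (π + t) • constL2 (avgL2 f) - (1 / (2 * π)) •
        ((∫ r in (0 : ℝ)..t + 2 * π, r • translate r f) - ∫ r in (0 : ℝ)..t, r • translate r f) := by
    funext t
    rw [translate_antiderivOp_eq, intervalIntegral.integral_interval_sub_left
      (hc.intervalIntegrable _ _) (hc.intervalIntegrable _ _)]
  rw [hsplit]
  have d0 : HasDerivAt (fun t : ℝ => ∫ r in (0 : ℝ)..t, r • translate r f) (h • translate h f) h :=
    intervalIntegral.integral_hasDerivAt_right (hc.intervalIntegrable _ _)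
      (hc.stronglyMeasurableAtFilter _ _) hc.continuousAt
  have d1 : HasDerivAt (fun t : ℝ => ∫ r in (0 : ℝ)..t + 2 * π, r • translate r f)
      ((h + 2 * π) • translate (h + 2 * π) f) h :=
    (intervalIntegral.integral_hasDerivAt_right (hc.intervalIntegrable _ _)
      (hc.stronglyMeasurableAtFilter _ _) hc.continuousAt : HasDerivAt _ _ (h + 2 * π)).comp_add_const h _
  have d2 : HasDerivAt (fun t : ℝ => (π + t) • constL2 (avgL2 f))
      ((1 : ℝ) • constL2 (avgL2 f)) h :=
    ((hasDerivAt_id h).const_add π).smul_const _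
  refine (d2.sub ((d1.sub d0).const_smul (1 / (2 * π)))).congr_deriv ?_
  rw [translate_two_pi_add, ← sub_smul, add_sub_cancel_left, smul_smul, one_div,
    inv_mul_cancel₀ Real.two_pi_pos.ne', one_smul, one_smul]

theorem avgL2_antiderivOp (f : L2) : avgL2 (antiderivOp f) = 0 := by
  rw [avgL2_eq_inner, real_inner_comm, inner_antiderivOp_left, antiderivOp_constL2, inner_zero_right,
    neg_zero]

/-- Differentiate `coef k (translate t (antiderivOp f))` at `t = 0` in two ways: through the
derivative of the translated antiderivative, and through the factor `exp(-ikt)`. -/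
theorem coef_antiderivOp {k : ℤ} (hk : k ≠ 0) (f : L2) :
    Complex.I * k * coef k (antiderivOp f) = coef k f := by
  have d1 : HasDerivAt (fun t => coef k (translate t (antiderivOp f)))
      (coef k (constL2 (avgL2 f) - translate 0 f)) 0 :=
    (coef k).hasFDerivAt.comp_hasDerivAt 0 (hasDerivAt_translate_antiderivOp f 0)
  simp_rw [coef_translate] at d1
  have d2 := (hasDerivAt_fourier_neg (2 * π) k 0).mul_const (coef k (antiderivOp f))
  have h := d1.unique d2
  rw [translate_zero, map_sub, coef_eq_zero_of_translate (fun t => translate_constL2 t _) hk] at h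
  have hpi : (π : ℂ) ≠ 0 := by exact_mod_cast Real.pi_ne_zero
  have h0 : fourier (-k) (((0 : ℝ) : Torus)) = 1 := by simp
  rw [h0] at h
  push_cast at h
  have h3 : -2 * (π : ℂ) * Complex.I * k / (2 * π) * 1 = -(Complex.I * k) := by
    field_simp
  rw [h3] at h
  linear_combination h

/-- The Poincaré inequality with constant 1: the zero mode vanishes and every other mode is divided
by `ik` with `|k| ≥ 1`. -/
theorem norm_antiderivOp_le (f : L2) : ‖antiderivOp f‖ ≤ ‖f‖ := by
  refine le_of_sq_le_sq ?_ (norm_nonneg _)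
  refine hasSum_le (fun k => ?_) (hasSum_sq_coef (antiderivOp f)) (hasSum_sq_coef f)
  by_cases hk : k = 0
  · subst hk
    rw [coef_zero, avgL2_antiderivOp]
    simp only [Complex.ofReal_zero, norm_zero, ne_eq, OfNat.ofNat_ne_zero, not_false_eq_true,
      zero_pow]
    positivity
  · rw [← coef_antiderivOp hk f, norm_mul, norm_mul, Complex.norm_I, one_mul, mul_pow]
    refine le_mul_of_one_le_left (by positivity) ?_
    rw [one_le_sq_iff_one_le_abs, abs_norm, Complex.norm_intCast]
    exact_mod_cast Int.one_le_abs hk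

end Antiderivative

/-! ### Identification of the pointwise primitive with `antiderivOp`. -/

section Primitive

theorem intervalIntegrable_lift (f : L2) : IntervalIntegrable (lift f) volume 0 (2 * π) := by
  have h1 : Integrable (f : Torus → ℝ) torusMeasure :=
    (Lp.memLp f).integrable (by norm_num)
  have h2 : Integrable (f : Torus → ℝ) volume := by
    rw [AddCircle.volume_eq_smul_haarAddCircle]
    exact h1.smul_measure ENNReal.ofReal_ne_top
  have h3 := (AddCircle.measurePreserving_mk (2 * π) 0).integrable_comp_of_integrable h2
  rw [intervalIntegrable_iff, Set.uIoc_of_le Real.two_pi_pos.le]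
  rw [zero_add] at h3
  exact h3

theorem zero_mem_uIcc : (0 : ℝ) ∈ Set.uIcc 0 (2 * π) := Set.left_mem_uIcc

theorem absolutelyContinuousOnInterval_antideriv (f : L2) :
    AbsolutelyContinuousOnInterval (antideriv f) 0 (2 * π) :=
  ((intervalIntegrable_lift f).absolutelyContinuousOnInterval_intervalIntegral zero_mem_uIcc).sub
    (LipschitzWith.const _).lipschitzOnWith.absolutelyContinuousOnInterval

theorem ae_deriv_antideriv (f : L2) :
    ∀ᵐ x, x ∈ Set.uIcc 0 (2 * π) → deriv (antideriv f) x = lift f x := by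
  filter_upwards [(intervalIntegrable_lift f).ae_hasDerivAt_integral] with x hx hmem
  exact ((hx hmem 0 zero_mem_uIcc).sub_const _).deriv

theorem antideriv_two_pi {f : L2} (hf : avgL2 f = 0) : antideriv f 0 = antideriv f (2 * π) := by
  have h : ∫ y in (0 : ℝ)..2 * π, lift f y = 0 := by
    have h := hf
    rw [avgL2, avg] at h
    exact (mul_eq_zero.1 h).resolve_left (by positivity)
  rw [antideriv, antideriv, h, intervalIntegral.integral_same]

/-- Integration by parts for absolutely continuous functions; zero average of `f` makes its
primitive periodic, which kills the boundary terms. -/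
theorem integral_antideriv_mul_deriv {f : L2} (hf : avgL2 f = 0) {g : ℝ → ℝ}
    (hg : AbsolutelyContinuousOnInterval g 0 (2 * π)) (hper : g (2 * π) = g 0) :
    ∫ x in (0 : ℝ)..2 * π, antideriv f x * deriv g x
      = -∫ x in (0 : ℝ)..2 * π, lift f x * g x := by
  rw [(absolutelyContinuousOnInterval_antideriv f).integral_mul_deriv_eq_deriv_mul hg, hper]
  rw [← antideriv_two_pi hf, sub_self, zero_sub, neg_inj]
  refine intervalIntegral.integral_congr_ae ?_
  filter_upwards [ae_deriv_antideriv f] with x hx hmem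
  rw [hx (Set.uIoc_subset_uIcc hmem)]

theorem continuousOn_antideriv (f : L2) : ContinuousOn (antideriv f) (Set.uIcc 0 (2 * π)) :=
  (absolutelyContinuousOnInterval_antideriv f).continuousOn

theorem integral_antideriv (f : L2) : ∫ x in (0 : ℝ)..2 * π, antideriv f x = 0 := by
  have h : ContinuousOn (fun x => ∫ y in (0 : ℝ)..x, lift f y) (Set.uIcc 0 (2 * π)) :=
    ((intervalIntegrable_lift f).absolutelyContinuousOnInterval_intervalIntegral
      zero_mem_uIcc).continuousOn
  simp only [antideriv]
  rw [intervalIntegral.integral_sub h.intervalIntegrable (by simp)]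
  rw [intervalIntegral.integral_const, avg, sub_zero, smul_eq_mul]
  field_simp
  ring

theorem fourier_neg_coe (k : ℤ) (x : ℝ) :
    fourier (-k) (x : Torus) = (cos (k * x) : ℂ) - (sin (k * x) : ℂ) * Complex.I := by
  rw [fourier_coe_apply]
  have hpi : (π : ℂ) ≠ 0 := by exact_mod_cast Real.pi_ne_zero
  have : (2 * (π : ℂ) * Complex.I * ((-k : ℤ) : ℂ) * (x : ℂ) / ((2 * π : ℝ) : ℂ))
      = ((-(k * x) : ℝ) : ℂ) * Complex.I := by
    push_cast
    field_simp
  rw [this, Complex.exp_ofReal_mul_I, Real.cos_neg, Real.sin_neg]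
  push_cast
  ring

theorem integral_fourier_mul_ofReal (k : ℤ) {h : ℝ → ℝ}
    (hh : IntervalIntegrable h volume 0 (2 * π)) :
    ∫ x in (0 : ℝ)..2 * π, fourier (-k) (x : Torus) * (h x : ℂ)
      = ((∫ x in (0 : ℝ)..2 * π, h x * cos (k * x) : ℝ) : ℂ)
        - ((∫ x in (0 : ℝ)..2 * π, h x * sin (k * x) : ℝ) : ℂ) * Complex.I := by
  have hc : IntervalIntegrable (fun x => h x * cos (k * x)) volume 0 (2 * π) :=
    hh.mul_continuousOn (by fun_prop)
  have hs : IntervalIntegrable (fun x => h x * sin (k * x)) volume 0 (2 * π) :=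
    hh.mul_continuousOn (by fun_prop)
  have hc' : IntervalIntegrable (fun x => ((h x * cos (k * x) : ℝ) : ℂ)) volume 0 (2 * π) :=
    ⟨hc.1.ofReal, hc.2.ofReal⟩
  have hs' : IntervalIntegrable (fun x => ((h x * sin (k * x) : ℝ) : ℂ)) volume 0 (2 * π) :=
    ⟨hs.1.ofReal, hs.2.ofReal⟩
  rw [← intervalIntegral.integral_ofReal, ← intervalIntegral.integral_ofReal,
    ← intervalIntegral.integral_mul_const, ← intervalIntegral.integral_sub hc' (hs'.mul_const _)]
  refine intervalIntegral.integral_congr fun x _ => ?_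
  simp only [fourier_neg_coe]
  push_cast
  ring

theorem hasDerivAt_sin_mul (k : ℤ) (x : ℝ) :
    HasDerivAt (fun x : ℝ => sin (k * x)) (k * cos (k * x)) x := by
  simpa [mul_comm] using ((hasDerivAt_id x).const_mul (k : ℝ)).sin

theorem hasDerivAt_cos_mul (k : ℤ) (x : ℝ) :
    HasDerivAt (fun x : ℝ => cos (k * x)) (-(k * sin (k * x))) x := by
  simpa [mul_comm] using ((hasDerivAt_id x).const_mul (k : ℝ)).cos

theorem absolutelyContinuousOnInterval_of_bounded_deriv {g g' : ℝ → ℝ} {C a b : ℝ}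
    (hg : ∀ x, HasDerivAt g (g' x) x) (hC : ∀ x, |g' x| ≤ C) :
    AbsolutelyContinuousOnInterval g a b := by
  have h0 : 0 ≤ C := (abs_nonneg _).trans (hC 0)
  refine LipschitzOnWith.absolutelyContinuousOnInterval (K := ⟨C, h0⟩) ?_
  refine (lipschitzWith_of_nnnorm_deriv_le (fun x => (hg x).differentiableAt) fun x => ?_).lipschitzOnWith
  rw [(hg x).deriv]
  exact hC x

theorem integral_antideriv_mul_cos {f : L2} (hf : avgL2 f = 0) (k : ℤ) :
    k * ∫ x in (0 : ℝ)..2 * π, antideriv f x * cos (k * x)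
      = -∫ x in (0 : ℝ)..2 * π, lift f x * sin (k * x) := by
  have hac : AbsolutelyContinuousOnInterval (fun x : ℝ => sin (k * x)) 0 (2 * π) := by
    refine absolutelyContinuousOnInterval_of_bounded_deriv (C := |(k : ℝ)|)
      (hasDerivAt_sin_mul k) fun x => ?_
    rw [abs_mul]
    exact mul_le_of_le_one_right (abs_nonneg _) (abs_cos_le_one _)
  rw [← integral_antideriv_mul_deriv hf hac (by simpa using Real.sin_periodic.int_mul_eq k),
    ← intervalIntegral.integral_const_mul]
  refine intervalIntegral.integral_congr fun x _ => ?_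
  simp only [(hasDerivAt_sin_mul k x).deriv]
  ring

theorem integral_antideriv_mul_sin {f : L2} (hf : avgL2 f = 0) (k : ℤ) :
    k * ∫ x in (0 : ℝ)..2 * π, antideriv f x * sin (k * x)
      = ∫ x in (0 : ℝ)..2 * π, lift f x * cos (k * x) := by
  have hac : AbsolutelyContinuousOnInterval (fun x : ℝ => cos (k * x)) 0 (2 * π) := by
    refine absolutelyContinuousOnInterval_of_bounded_deriv (C := |(k : ℝ)|)
      (hasDerivAt_cos_mul k) fun x => ?_
    rw [abs_neg, abs_mul]
    exact mul_le_of_le_one_right (abs_nonneg _) (abs_sin_le_one _)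
  have h := integral_antideriv_mul_deriv hf hac (by simp [Real.cos_int_mul_two_pi])
  rw [← neg_inj, ← h, ← neg_mul, ← intervalIntegral.integral_const_mul]
  refine intervalIntegral.integral_congr fun x _ => ?_
  simp only [(hasDerivAt_cos_mul k x).deriv]
  ring

/-- The anti-derivative of a function with zero average, as a continuous function on the torus. -/
noncomputable def antiderivTorus {f : L2} (hf : avgL2 f = 0) : C(Torus, ℝ) :=
  ⟨AddCircle.liftIoc (2 * π) 0 (antideriv f), AddCircle.liftIoc_zero_continuous (antideriv_two_pi hf)
    (by simpa [Set.uIcc_of_le Real.two_pi_pos.le] using continuousOn_antideriv f)⟩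

theorem antiderivTorus_coe {f : L2} (hf : avgL2 f = 0) {x : ℝ} (hx : x ∈ Set.Ioc 0 (2 * π)) :
    antiderivTorus hf (x : Torus) = antideriv f x :=
  AddCircle.liftIoc_zero_coe_apply (f := antideriv f) hx

theorem coef_toLp (k : ℤ) (g : C(Torus, ℝ)) :
    coef k (ContinuousMap.toLp 2 torusMeasure ℝ g) = (1 / (2 * π)) •
      ∫ x in (0 : ℝ)..2 * π, fourier (-k) (x : Torus) * (g (x : Torus) : ℂ) := by
  rw [coef_eq_fourierCoeff, fourierCoeff]
  rw [integral_congr_ae (g := fun x : Torus => fourier (-k) x * (g x : ℂ)),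
    integral_haar_eq_interval]
  filter_upwards [ContinuousMap.coeFn_toLp (p := 2) (𝕜 := ℝ) torusMeasure g] with x hx
  rw [hx, smul_eq_mul]

/-- Both sides have zero average, and testing the primitive against `cos` and `sin` shows that its
other coefficients obey the same relation `ik · coef = coef f`. -/
theorem toLp_antiderivTorus {f : L2} (hf : avgL2 f = 0) :
    ContinuousMap.toLp 2 torusMeasure ℝ (antiderivTorus hf) = antiderivOp f := by
  refine ext_coef fun k => ?_
  have hA : coef k (ContinuousMap.toLp 2 torusMeasure ℝ (antiderivTorus hf)) = (1 / (2 * π)) •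
      (((∫ x in (0 : ℝ)..2 * π, antideriv f x * cos (k * x) : ℝ) : ℂ)
        - ((∫ x in (0 : ℝ)..2 * π, antideriv f x * sin (k * x) : ℝ) : ℂ) * Complex.I) := by
    rw [coef_toLp, ← integral_fourier_mul_ofReal k (continuousOn_antideriv f).intervalIntegrable]
    congr 1
    refine intervalIntegral.integral_congr_ae (ae_of_all _ fun x hx => ?_)
    rw [Set.uIoc_of_le Real.two_pi_pos.le] at hx
    rw [antiderivTorus_coe hf hx]
  by_cases hk : k = 0
  · subst hk
    rw [hA, coef_zero, avgL2_antiderivOp]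
    simp [integral_antideriv]
  · have hk' : Complex.I * (k : ℂ) ≠ 0 := mul_ne_zero Complex.I_ne_zero (by exact_mod_cast hk)
    refine mul_left_cancel₀ hk' ?_
    rw [coef_antiderivOp hk, hA, coef_eq_intervalIntegral,
      integral_fourier_mul_ofReal k (intervalIntegrable_lift f), mul_smul_comm]
    congr 1
    have hc := integral_antideriv_mul_cos hf k
    have hs := integral_antideriv_mul_sin hf k
    rw [← hs, ← neg_eq_iff_eq_neg.2 hc]
    push_cast
    linear_combination (-(k : ℂ) * ((∫ x in (0 : ℝ)..2 * π, antideriv f x * sin (k * x) : ℝ) : ℂ)) *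
      Complex.I_mul_I

theorem integral_antideriv_mul {f : L2} (hf : avgL2 f = 0) (g : L2) :
    ∫ x in (0 : ℝ)..2 * π, antideriv f x * lift g x = 2 * π * ⟪antiderivOp f, g⟫ := by
  have h : ⟪antiderivOp f, g⟫ = ∫ x, antiderivTorus hf x * g x ∂torusMeasure := by
    rw [← toLp_antiderivTorus hf, L2.inner_def]
    refine integral_congr_ae ?_
    filter_upwards [ContinuousMap.coeFn_toLp (p := 2) (𝕜 := ℝ) torusMeasure (antiderivTorus hf)]
      with x hx
    rw [hx]
    simp [mul_comm]
  rw [h, integral_haar_eq_interval, smul_eq_mul, ← mul_assoc, mul_one_div_cancel Real.two_pi_pos.ne',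
    one_mul]
  refine intervalIntegral.integral_congr_ae (ae_of_all _ fun x hx => ?_)
  rw [Set.uIoc_of_le Real.two_pi_pos.le] at hx
  rw [antiderivTorus_coe hf hx]
  rfl

theorem entropy_eq (θ : ℝ) {f : L2} (hf : avgL2 f = 0) (g : L2) :
    entropy θ f g = ‖f‖ ^ 2 + ‖g‖ ^ 2 - θ * ⟪antiderivOp f, g⟫ := by
  rw [entropy, integral_antideriv_mul hf]
  field_simp

end Primitive

/-! ### Multiplication by the relaxation coefficient. -/

section Multiplication

/-- The multiplication by `σ` as a bounded operator on `L²(𝕋)`. -/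
noncomputable def mulOp (σ : LInfty) : L2 →L[ℝ] L2 :=
  LinearMap.mkContinuous
    { toFun := fun f => (σ • f : L2)
      map_add' := fun f g => Lp.add_smul σ f g
      map_smul' := fun c f => (Lp.smul_comm c σ f).symm }
    ‖σ‖ fun f => Lp.norm_smul_le σ f

theorem mulOp_apply (σ : LInfty) (f : L2) : mulOp σ f = (σ • f : L2) := rfl

theorem coeFn_mulOp (σ : LInfty) (f : L2) :
    (mulOp σ f : Torus → ℝ) =ᵐ[torusMeasure] fun x => σ x * f x :=
  Lp.coeFn_lpSMul σ f

end Multiplication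

/-! ### Duhamel's formula along characteristics and conservation of mass. -/

section Characteristics

theorem continuous_translate_uncurry : Continuous fun p : ℝ × L2 => translate p.1 p.2 :=
  continuous_translate_comp continuous_fst continuous_snd

theorem tendsto_translate {X : Type*} {l : Filter X} {a : X → ℝ} {f : X → L2} {a₀ : ℝ} {f₀ : L2}
    (ha : Tendsto a l (𝓝 a₀)) (hf : Tendsto f l (𝓝 f₀)) :
    Tendsto (fun x => translate (a x) (f x)) l (𝓝 (translate a₀ f₀)) := by
  have h := (continuous_translate_uncurry.tendsto (a₀, f₀)).comp (ha.prodMk_nhds hf)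
  simp only [Function.comp_def] at h
  exact h

/-- A product rule without differentiability of the group on all of `L²`: only the orbit of the
single vector `z t` must be differentiable, the other part of the slope converging by joint
continuity. -/
theorem hasDerivAt_translate_curve {a : ℝ → ℝ} {z : ℝ → L2} {z' d : L2} {t : ℝ}
    (ha : ContinuousAt a t) (hz : HasDerivAt z z' t)
    (hd : HasDerivAt (fun s => translate (a s) (z t)) d t) :
    HasDerivAt (fun s => translate (a s) (z s)) (d + translate (a t) z') t := by
  rw [hasDerivAt_iff_tendsto_slope] at hz hd ⊢
  have h : slope (fun s => translate (a s) (z s)) t = fun s =>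
      slope (fun s => translate (a s) (z t)) t s + translate (a s) (slope z t s) := by
    funext s
    simp only [slope_def_module, translate_smul, translate_sub]
    rw [← smul_add]
    congr 1
    abel
  rw [h]
  refine hd.add ?_
  exact tendsto_translate (ha.tendsto.mono_left nhdsWithin_le_nhds) hz

variable {σ : LInfty} {u₀ v₀ : L2} {u v : ℝ → L2}

/-- The relaxation source `σ v`, frozen for negative times. -/
noncomputable def source (σ : LInfty) (v : ℝ → L2) (s : ℝ) : L2 := mulOp σ (v (max s 0))

theorem IsMildSolution.continuous_source (h : IsMildSolution σ u₀ v₀ u v) :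
    Continuous (source σ v) := by
  refine (mulOp σ).continuous.comp ?_
  exact h.continuousOn_v.comp_continuous (continuous_id.max continuous_const)
    fun s => le_max_right s 0

/-- The profile of `u + v` along the characteristics of velocity `1`. -/
noncomputable def profilePlus (σ : LInfty) (u₀ v₀ : L2) (v : ℝ → L2) (t : ℝ) : L2 :=
  (u₀ + v₀) - ∫ s in (0 : ℝ)..t, translate (-s) (source σ v s)

/-- The profile of `u - v` along the characteristics of velocity `-1`. -/
noncomputable def profileMinus (σ : LInfty) (u₀ v₀ : L2) (v : ℝ → L2) (t : ℝ) : L2 :=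
  (u₀ - v₀) + ∫ s in (0 : ℝ)..t, translate s (source σ v s)

/-- Freezing the source at negative times makes it continuous on all of `ℝ`, so the derivative is
two-sided even at `t = 0`. -/
theorem IsMildSolution.hasDerivAt_profilePlus (h : IsMildSolution σ u₀ v₀ u v) (t : ℝ) :
    HasDerivAt (profilePlus σ u₀ v₀ v) (-translate (-t) (source σ v t)) t := by
  have hc : Continuous fun s => translate (-s) (source σ v s) :=
    continuous_translate_comp continuous_neg h.continuous_source
  exact (intervalIntegral.integral_hasDerivAt_right (hc.intervalIntegrable _ _)
    (hc.stronglyMeasurableAtFilter _ _) hc.continuousAt).const_sub _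

theorem IsMildSolution.hasDerivAt_profileMinus (h : IsMildSolution σ u₀ v₀ u v) (t : ℝ) :
    HasDerivAt (profileMinus σ u₀ v₀ v) (translate t (source σ v t)) t := by
  have hc : Continuous fun s => translate s (source σ v s) :=
    continuous_translate_comp continuous_id h.continuous_source
  exact (intervalIntegral.integral_hasDerivAt_right (hc.intervalIntegrable _ _)
    (hc.stronglyMeasurableAtFilter _ _) hc.continuousAt).const_add _

theorem continuous_freeFlow_comp {X : Type*} [TopologicalSpace X] {a : X → ℝ} {w : X → L2 × L2}
    (ha : Continuous a) (hw : Continuous w) : Continuous fun x => freeFlow (a x) (w x) := by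
  have h1 : Continuous fun x => translate (a x) ((w x).1 + (w x).2) :=
    continuous_translate_comp ha (hw.fst.add hw.snd)
  have h2 : Continuous fun x => translate (-a x) ((w x).1 - (w x).2) :=
    continuous_translate_comp ha.neg (hw.fst.sub hw.snd)
  exact ((h1.add h2).const_smul (2⁻¹ : ℝ)).prodMk ((h1.sub h2).const_smul (2⁻¹ : ℝ))

theorem freeFlow_fst_add_snd (t : ℝ) (w : L2 × L2) :
    (freeFlow t w).1 + (freeFlow t w).2 = translate t (w.1 + w.2) := by
  simp only [freeFlow]
  module

theorem freeFlow_fst_sub_snd (t : ℝ) (w : L2 × L2) :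
    (freeFlow t w).1 - (freeFlow t w).2 = translate (-t) (w.1 - w.2) := by
  simp only [freeFlow]
  module

theorem IsMildSolution.duhamel_source (h : IsMildSolution σ u₀ v₀ u v) {t : ℝ} (ht : 0 ≤ t) :
    (u t, v t) = freeFlow t (u₀, v₀)
      + ∫ s in (0 : ℝ)..t, freeFlow (t - s) (0, -source σ v s) := by
  rw [h.duhamel t ht]
  congr 1
  refine intervalIntegral.integral_congr fun s hs => ?_
  rw [Set.uIcc_of_le ht] at hs
  simp only [relaxation, source, max_eq_left hs.1, mulOp_apply]

theorem IsMildSolution.continuous_integrand (h : IsMildSolution σ u₀ v₀ u v) (t : ℝ) :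
    Continuous fun s => freeFlow (t - s) (0, -source σ v s) :=
  continuous_freeFlow_comp (continuous_const.sub continuous_id)
    (continuous_const.prodMk h.continuous_source.neg)

/-- The sum of the components diagonalises the free flow, so `translate t` factors out of the whole
Duhamel formula. -/
theorem IsMildSolution.add_eq (h : IsMildSolution σ u₀ v₀ u v) {t : ℝ} (ht : 0 ≤ t) :
    u t + v t = translate t (profilePlus σ u₀ v₀ v t) := by
  have hc : Continuous fun s => translate (-s) (source σ v s) :=
    continuous_translate_comp continuous_neg h.continuous_source
  have h1 := congrArg (ContinuousLinearMap.fst ℝ L2 L2 + ContinuousLinearMap.snd ℝ L2 L2)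
    (h.duhamel_source ht)
  rw [map_add, ← ContinuousLinearMap.intervalIntegral_comp_comm _
    ((h.continuous_integrand t).intervalIntegrable _ _)] at h1
  simp only [add_apply, ContinuousLinearMap.coe_fst',
    ContinuousLinearMap.coe_snd', freeFlow_fst_add_snd] at h1
  rw [h1, profilePlus, translate_sub, translate_intervalIntegral _ _ _ hc]
  simp only [zero_add, translate_neg, intervalIntegral.integral_neg, translate_translate]
  rw [sub_eq_add_neg]
  simp only [neg_add_eq_sub]

theorem IsMildSolution.sub_eq (h : IsMildSolution σ u₀ v₀ u v) {t : ℝ} (ht : 0 ≤ t) :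
    u t - v t = translate (-t) (profileMinus σ u₀ v₀ v t) := by
  have hc : Continuous fun s => translate s (source σ v s) :=
    continuous_translate_comp continuous_id h.continuous_source
  have h1 := congrArg (ContinuousLinearMap.fst ℝ L2 L2 - ContinuousLinearMap.snd ℝ L2 L2)
    (h.duhamel_source ht)
  rw [map_add, ← ContinuousLinearMap.intervalIntegral_comp_comm _
    ((h.continuous_integrand t).intervalIntegrable _ _)] at h1
  simp only [sub_apply, ContinuousLinearMap.coe_fst',
    ContinuousLinearMap.coe_snd', freeFlow_fst_sub_snd] at h1
  rw [h1, profileMinus, translate_add, translate_intervalIntegral _ _ _ hc]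
  simp only [zero_sub, neg_neg, translate_translate, neg_sub]
  simp only [sub_eq_add_neg]

theorem avgL2_add (f g : L2) : avgL2 (f + g) = avgL2 f + avgL2 g := by
  simp only [avgL2_eq_inner, inner_add_right]

theorem avgL2_sub (f g : L2) : avgL2 (f - g) = avgL2 f - avgL2 g := by
  simp only [avgL2_eq_inner, inner_sub_right]

theorem avgL2_smul (c : ℝ) (f : L2) : avgL2 (c • f) = c * avgL2 f := by
  simp only [avgL2_eq_inner, inner_smul_right]

theorem avgL2_translate (t : ℝ) (f : L2) : avgL2 (translate t f) = avgL2 f := by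
  rw [avgL2_eq_inner, ← translate_constL2 t, inner_translate_translate, ← avgL2_eq_inner]

theorem avgL2_intervalIntegral (a b : ℝ) {F : ℝ → L2} (hF : Continuous F) :
    avgL2 (∫ s in a..b, F s) = ∫ s in a..b, avgL2 (F s) := by
  simp only [avgL2_eq_inner, inner_intervalIntegral_right _ _ _ hF]

/-- The mass of `u` is conserved. -/
theorem IsMildSolution.avgL2_eq (h : IsMildSolution σ u₀ v₀ u v) {t : ℝ} (ht : 0 ≤ t) :
    avgL2 (u t) = avgL2 u₀ := by
  have h1 := congrArg avgL2 (h.add_eq ht)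
  have h2 := congrArg avgL2 (h.sub_eq ht)
  have hc1 : Continuous fun s => translate (-s) (source σ v s) :=
    continuous_translate_comp continuous_neg h.continuous_source
  have hc2 : Continuous fun s => translate s (source σ v s) :=
    continuous_translate_comp continuous_id h.continuous_source
  rw [avgL2_add, avgL2_translate, profilePlus, avgL2_sub, avgL2_intervalIntegral _ _ hc1,
    avgL2_add] at h1
  rw [avgL2_sub, avgL2_translate, profileMinus, avgL2_add, avgL2_intervalIntegral _ _ hc2,
    avgL2_sub] at h2
  simp only [avgL2_translate] at h1 h2
  -- The source enters the averages of `u + v` and `u - v` with opposite signs and cancels in their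
  -- sum.
  linarith

end Characteristics

/-! ### Entropy dissipation and comparison with the norm. -/

section Dissipation

theorem hasDerivAt_translate_neg_two_mul (f : L2) (t : ℝ) :
    HasDerivAt (fun s => translate (-2 * s) (antiderivOp f))
      ((-2 : ℝ) • (constL2 (avgL2 f) - translate (-2 * t) f)) t := by
  have h : HasDerivAt (fun s : ℝ => -2 * s) (-2) t := by
    simpa using (hasDerivAt_id t).const_mul (-2 : ℝ)
  exact (hasDerivAt_translate_antiderivOp f (-2 * t)).scomp t h

/-- Here `a`, `b`, `k` stand for `u t`, `v t`, `σ v t`. Going back from `P`, `M` to `a`, `b`,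
skewness of `antiderivOp` cancels the terms `⟪antiderivOp b, k⟫` and doubles those in `a`. -/
theorem hasDerivAt_profile_entropy {P M : ℝ → L2} {k : L2} {t : ℝ} (θ : ℝ)
    (hP : HasDerivAt P (-translate (-t) k) t) (hM : HasDerivAt M (translate t k) t)
    {a b : L2} (hp : a + b = translate t (P t)) (hm : a - b = translate (-t) (M t)) :
    HasDerivAt (fun s => (1 / 2) * (‖P s‖ ^ 2 + ‖M s‖ ^ 2)
        - (θ / 2) * ⟪translate (-2 * s) (antiderivOp (M s)), P s⟫)
      (-2 * ⟪b, k⟫ - θ * (‖a‖ ^ 2 - avgL2 a ^ 2 - ‖b‖ ^ 2 + avgL2 b ^ 2)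
        + θ * ⟪antiderivOp a, k⟫) t := by
  have hJM : HasDerivAt (fun s => antiderivOp (M s)) (antiderivOp (translate t k)) t :=
    antiderivOp.hasFDerivAt.comp_hasDerivAt t hM
  have hT : HasDerivAt (fun s => translate (-2 * s) (antiderivOp (M s)))
      ((-2 : ℝ) • (constL2 (avgL2 (M t)) - translate (-2 * t) (M t))
        + translate (-2 * t) (antiderivOp (translate t k))) t :=
    hasDerivAt_translate_curve (by fun_prop) hJM (hasDerivAt_translate_neg_two_mul (M t) t)
  have hd := ((hP.norm_sq.add hM.norm_sq).const_mul (1 / 2 : ℝ)).sub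
    ((hT.inner ℝ hP).const_mul (θ / 2))
  refine hd.congr_deriv ?_
  have hPt : P t = translate (-t) (a + b) := by
    rw [hp, translate_translate, add_neg_cancel, translate_zero]
  have hMt : M t = translate t (a - b) := by
    rw [hm, translate_translate, neg_add_cancel, translate_zero]
  have e1 : ⟪P t, -translate (-t) k⟫ = -⟪a + b, k⟫ := by
    rw [hPt, inner_neg_right, inner_translate_translate]
  have e2 : ⟪M t, translate t k⟫ = ⟪a - b, k⟫ := by
    rw [hMt, inner_translate_translate]
  have e3 : translate (-2 * t) (M t) = translate (-t) (a - b) := by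
    rw [hMt, translate_translate]; congr 1; ring
  have e4 : translate (-2 * t) (antiderivOp (translate t k)) = translate (-t) (antiderivOp k) := by
    rw [← translate_antiderivOp, translate_translate]; congr 1; ring
  have e5 : translate (-2 * t) (antiderivOp (M t)) = translate (-t) (antiderivOp (a - b)) := by
    rw [translate_antiderivOp, e3, translate_antiderivOp]
  have e6 : avgL2 (M t) = avgL2 a - avgL2 b := by rw [hMt, avgL2_translate, avgL2_sub]
  have e7 : avgL2 (P t) = avgL2 a + avgL2 b := by rw [hPt, avgL2_translate, avgL2_add]
  rw [e1, e2, e3, e4, e5, inner_add_left (_ • _), real_inner_smul_left,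
    inner_sub_left (constL2 _), inner_constL2_left, e6, e7, inner_neg_right, hPt]
  simp only [inner_translate_translate]
  have e8 : ⟪antiderivOp k, a⟫ = -⟪antiderivOp a, k⟫ := by
    rw [inner_antiderivOp_left, real_inner_comm]
  have e9 : ⟪antiderivOp k, b⟫ = -⟪antiderivOp b, k⟫ := by
    rw [inner_antiderivOp_left, real_inner_comm]
  simp only [inner_add_left, inner_sub_left, inner_add_right, map_sub, e8, e9,
    real_inner_self_eq_norm_sq, real_inner_comm a b]
  ring

/-- Comparing squares instead of completing the square avoids dividing by `A`, which vanishes when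
`α = θ`, as for constant `σ < 2`. -/
theorem quadratic_form_nonneg {A B C x y : ℝ} (hA : 0 ≤ A) (hC : 0 ≤ C) (h : B ^ 2 ≤ 4 * A * C) :
    0 ≤ A * x ^ 2 + C * y ^ 2 - B * (x * y) := by
  have h0 : 0 ≤ A * x ^ 2 + C * y ^ 2 := by positivity
  have h1 : (B * (x * y)) ^ 2 ≤ (A * x ^ 2 + C * y ^ 2) ^ 2 := by
    nlinarith [sq_nonneg (A * x ^ 2 - C * y ^ 2), mul_le_mul_of_nonneg_right h (sq_nonneg (x * y))]
  linarith [abs_le_of_sq_le_sq' h1 h0 |>.2]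

/-- The pointwise condition under which `E_θ` decays at the rate `α`. -/
def RateCondition (θ α s : ℝ) : Prop :=
  0 ≤ 2 * s - θ - α ∧ (θ * (s - α)) ^ 2 ≤ 4 * (θ - α) * (2 * s - θ - α)

theorem dissipation_nonneg {σ : LInfty} {θ α : ℝ} (hα : α ≤ θ)
    (hσ : ∀ᵐ x ∂torusMeasure, RateCondition θ α (σ x)) (F g : L2) :
    0 ≤ (θ - α) * ‖F‖ ^ 2 + 2 * ⟪g, mulOp σ g⟫ - (θ + α) * ‖g‖ ^ 2 - θ * ⟪F, mulOp σ g⟫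
      + θ * α * ⟪F, g⟫ := by
  have key : 0 ≤ ⟪F, (θ - α) • F - θ • mulOp σ g + (θ * α) • g⟫
      + ⟪g, (2 : ℝ) • mulOp σ g - (θ + α) • g⟫ := by
    -- Grouped into two inner products, the expression becomes the integral of the quadratic form in
    -- the values of `F` and `g`.
    rw [L2.inner_def, L2.inner_def, ← integral_add (L2.integrable_inner _ _)
      (L2.integrable_inner _ _)]
    refine integral_nonneg_of_ae ?_
    filter_upwards [hσ, coeFn_mulOp σ g,
      Lp.coeFn_add ((θ - α) • F - θ • mulOp σ g) ((θ * α) • g),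
      Lp.coeFn_sub ((θ - α) • F) (θ • mulOp σ g), Lp.coeFn_smul (θ - α) F,
      Lp.coeFn_smul θ (mulOp σ g), Lp.coeFn_smul (θ * α) g,
      Lp.coeFn_sub ((2 : ℝ) • mulOp σ g) ((θ + α) • g), Lp.coeFn_smul (2 : ℝ) (mulOp σ g),
      Lp.coeFn_smul (θ + α) g] with x h0 h1 h2 h3 h4 h5 h6 h7 h8 h9
    rw [h2, h7]
    simp only [Pi.add_apply, Pi.sub_apply, h3, h4, h5, h6, h8, h9, Pi.smul_apply, h1, smul_eq_mul,
      Pi.zero_apply, RCLike.inner_apply, conj_trivial]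
    have hq := quadratic_form_nonneg (x := F x) (y := g x) (sub_nonneg.2 hα) h0.1 h0.2
    linarith
  simp only [inner_add_right, inner_sub_right, real_inner_smul_right,
    real_inner_self_eq_norm_sq] at key
  linarith

theorem le_mul_exp_of_hasDerivAt {E E' : ℝ → ℝ} {α : ℝ} (hE : ∀ t, 0 ≤ t → HasDerivAt E (E' t) t)
    (h : ∀ t, 0 ≤ t → E' t ≤ -α * E t) {t : ℝ} (ht : 0 ≤ t) : E t ≤ E 0 * Real.exp (-α * t) := by
  have hd : ∀ s, 0 ≤ s → HasDerivAt (fun s => E s * Real.exp (α * s))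
      (E' s * Real.exp (α * s) + E s * (Real.exp (α * s) * α)) s := by
    intro s hs
    have h1 : HasDerivAt (fun s => Real.exp (α * s)) (Real.exp (α * s) * α) s := by
      simpa using ((hasDerivAt_id s).const_mul α).exp
    exact (hE s hs).mul h1
  have hanti : AntitoneOn (fun s => E s * Real.exp (α * s)) (Set.Ici 0) := by
    refine antitoneOn_of_deriv_nonpos (convex_Ici 0)
      (fun s hs => (hd s hs).continuousAt.continuousWithinAt)
      (fun s hs => (hd s (interior_subset hs)).differentiableAt.differentiableWithinAt)
      fun s hs => ?_
    rw [(hd s (interior_subset hs)).deriv]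
    have := mul_le_mul_of_nonneg_right (h s (interior_subset hs)) (Real.exp_pos (α * s)).le
    linarith
  have h2 : E t * Real.exp (α * t) ≤ E 0 * Real.exp (α * 0) :=
    hanti (Set.mem_Ici.2 le_rfl) ht ht
  rw [mul_zero, Real.exp_zero, mul_one] at h2
  rw [neg_mul, Real.exp_neg, ← div_eq_mul_inv, le_div_iff₀ (Real.exp_pos _)]
  exact h2

theorem norm_sub_constL2_avgL2_sq (f : L2) :
    ‖f - constL2 (avgL2 f)‖ ^ 2 = ‖f‖ ^ 2 - avgL2 f ^ 2 := by
  rw [norm_sub_sq_real, real_inner_comm, inner_constL2_left, ← real_inner_self_eq_norm_sq (constL2 _),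
    inner_constL2_left, avgL2_constL2]
  ring

theorem avgL2_sub_constL2_avgL2 (f : L2) : avgL2 (f - constL2 (avgL2 f)) = 0 := by
  rw [avgL2_sub, avgL2_constL2, sub_self]

theorem antiderivOp_sub_constL2 (f : L2) (c : ℝ) : antiderivOp (f - constL2 c) = antiderivOp f := by
  rw [map_sub, antiderivOp_constL2, sub_zero]

variable {σ : LInfty} {u₀ v₀ : L2} {u v : ℝ → L2}

theorem IsMildSolution.zero_eq (h : IsMildSolution σ u₀ v₀ u v) : u 0 = u₀ ∧ v 0 = v₀ := by
  have h1 := h.add_eq le_rfl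
  have h2 := h.sub_eq le_rfl
  simp only [profilePlus, profileMinus, intervalIntegral.integral_same, neg_zero, translate_zero,
    sub_zero, add_zero] at h1 h2
  constructor
  · have h3 : (2 : ℝ) • u 0 = (2 : ℝ) • u₀ := by
      calc (2 : ℝ) • u 0 = (u 0 + v 0) + (u 0 - v 0) := by module
        _ = (2 : ℝ) • u₀ := by rw [h1, h2]; module
    exact smul_right_injective _ (two_ne_zero : (2 : ℝ) ≠ 0) h3
  · have h3 : (2 : ℝ) • v 0 = (2 : ℝ) • v₀ := by
      calc (2 : ℝ) • v 0 = (u 0 + v 0) - (u 0 - v 0) := by module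
        _ = (2 : ℝ) • v₀ := by rw [h1, h2]; module
    exact smul_right_injective _ (two_ne_zero : (2 : ℝ) ≠ 0) h3

/-- The shift by `-2t` compensates the opposite velocities of the two profiles; skewness removes the
diagonal terms of `⟪antiderivOp (u - v), u + v⟫` and makes the cross terms equal. -/
theorem IsMildSolution.entropy_eq_profile (h : IsMildSolution σ u₀ v₀ u v) (θ : ℝ) {t : ℝ}
    (ht : 0 ≤ t) :
    entropy θ (u t - constL2 (avgL2 u₀)) (v t) =
      (1 / 2) * (‖profilePlus σ u₀ v₀ v t‖ ^ 2 + ‖profileMinus σ u₀ v₀ v t‖ ^ 2)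
        - (θ / 2) * ⟪translate (-2 * t) (antiderivOp (profileMinus σ u₀ v₀ v t)),
            profilePlus σ u₀ v₀ v t⟫ - avgL2 u₀ ^ 2 := by
  set P := profilePlus σ u₀ v₀ v t with hPdef
  set M := profileMinus σ u₀ v₀ v t with hMdef
  have hp : u t + v t = translate t P := h.add_eq ht
  have hm : u t - v t = translate (-t) M := h.sub_eq ht
  rw [← h.avgL2_eq ht, entropy_eq θ (avgL2_sub_constL2_avgL2 _), norm_sub_constL2_avgL2_sq,
    antiderivOp_sub_constL2]
  have n1 : ‖P‖ ^ 2 = ‖u t + v t‖ ^ 2 := by rw [hp, norm_translate]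
  have n2 : ‖M‖ ^ 2 = ‖u t - v t‖ ^ 2 := by rw [hm, norm_translate]
  have e1 : ⟪translate (-2 * t) (antiderivOp M), P⟫ = ⟪antiderivOp (u t - v t), u t + v t⟫ := by
    rw [hm, hp, ← translate_antiderivOp, inner_translate_left (-t), translate_translate,
      inner_translate_left]
    congr 2
    ring
  rw [n1, n2, e1, norm_add_sq_real, norm_sub_sq_real, map_sub]
  simp only [inner_sub_left, inner_add_right, inner_antiderivOp_self]
  have e2 : ⟪antiderivOp (v t), u t⟫ = -⟪antiderivOp (u t), v t⟫ := by
    rw [inner_antiderivOp_left, real_inner_comm]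
  rw [e2]
  ring

theorem IsMildSolution.entropy_decay (h : IsMildSolution σ u₀ v₀ u v) {θ α : ℝ} (hθ : 0 ≤ θ)
    (hα : α ≤ θ) (hσ : ∀ᵐ x ∂torusMeasure, RateCondition θ α (σ x)) {t : ℝ} (ht : 0 ≤ t) :
    entropy θ (u t - constL2 (avgL2 u₀)) (v t)
      ≤ entropy θ (u₀ - constL2 (avgL2 u₀)) v₀ * Real.exp (-α * t) := by
  have h0 := h.entropy_eq_profile θ le_rfl
  rw [h.zero_eq.1, h.zero_eq.2] at h0
  rw [h.entropy_eq_profile θ ht, h0]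
  refine le_mul_exp_of_hasDerivAt (E := fun s =>
      (1 / 2) * (‖profilePlus σ u₀ v₀ v s‖ ^ 2 + ‖profileMinus σ u₀ v₀ v s‖ ^ 2)
        - (θ / 2) * ⟪translate (-2 * s) (antiderivOp (profileMinus σ u₀ v₀ v s)),
            profilePlus σ u₀ v₀ v s⟫ - avgL2 u₀ ^ 2)
    (fun s hs => (hasDerivAt_profile_entropy θ (h.hasDerivAt_profilePlus s)
      (h.hasDerivAt_profileMinus s) (h.add_eq hs) (h.sub_eq hs)).sub_const _) (fun s hs => ?_) ht
  rw [← h.entropy_eq_profile θ hs, ← h.avgL2_eq hs, entropy_eq θ (avgL2_sub_constL2_avgL2 _),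
    norm_sub_constL2_avgL2_sq, antiderivOp_sub_constL2, source, max_eq_left hs]
  have hd := dissipation_nonneg hα hσ (antiderivOp (u s)) (v s)
  have hF : ‖antiderivOp (u s)‖ ^ 2 ≤ ‖u s‖ ^ 2 - avgL2 (u s) ^ 2 := by
    rw [← norm_sub_constL2_avgL2_sq, ← antiderivOp_sub_constL2 (u s) (avgL2 (u s))]
    gcongr
    exact norm_antiderivOp_le _
  -- The Poincaré inequality enters with the weight `θ - α ≥ 0`, and the term `θ (v_avg)²` has a
  -- favourable sign.
  nlinarith [mul_le_mul_of_nonneg_left hF (sub_nonneg.2 hα), mul_nonneg hθ (sq_nonneg (avgL2 (v s)))]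

theorem constL2_smul (c a : ℝ) : constL2 (c * a) = c • constL2 a :=
  map_smul (Lp.constₗ 2 torusMeasure ℝ) c a

/-- The parallelogram law for `u - c` and `v`. -/
theorem distEquilibrium_sq (c : ℝ) (f g : L2) :
    distEquilibrium (c / 2) f g ^ 2 = (‖f - constL2 c‖ ^ 2 + ‖g‖ ^ 2) / 2 := by
  have hc : constL2 (c / 2) = (2⁻¹ : ℝ) • constL2 c := by rw [← constL2_smul]; congr 1; ring
  have h1 : (2⁻¹ : ℝ) • (f + g) - (2⁻¹ : ℝ) • constL2 c = (2⁻¹ : ℝ) • ((f - constL2 c) + g) := by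
    module
  have h2 : (2⁻¹ : ℝ) • (f - g) - (2⁻¹ : ℝ) • constL2 c = (2⁻¹ : ℝ) • ((f - constL2 c) - g) := by
    module
  rw [distEquilibrium, WithLp.prod_norm_sq_eq_of_L2]
  simp only [hc, h1, h2, WithLp.toLp_fst, WithLp.toLp_snd, norm_smul, mul_pow]
  rw [norm_add_sq_real, norm_sub_sq_real (f - constL2 c) g]
  norm_num
  ring

theorem abs_inner_antiderivOp_le (f g : L2) :
    |⟪antiderivOp f, g⟫| ≤ (‖f‖ ^ 2 + ‖g‖ ^ 2) / 2 := by
  have h1 : |⟪antiderivOp f, g⟫| ≤ ‖f‖ * ‖g‖ :=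
    (abs_real_inner_le_norm _ _).trans (by gcongr; exact norm_antiderivOp_le f)
  linarith [two_mul_le_add_sq ‖f‖ ‖g‖]

theorem distEquilibrium_nonneg (c : ℝ) (f g : L2) : 0 ≤ distEquilibrium c f g := norm_nonneg _

theorem entropy_bounds {θ : ℝ} (hθ : 0 ≤ θ) {f : L2} {c : ℝ} (hf : avgL2 f = c) (g : L2) :
    (2 - θ) * distEquilibrium (c / 2) f g ^ 2 ≤ entropy θ (f - constL2 c) g ∧
      entropy θ (f - constL2 c) g ≤ (2 + θ) * distEquilibrium (c / 2) f g ^ 2 := by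
  subst hf
  rw [distEquilibrium_sq, entropy_eq θ (avgL2_sub_constL2_avgL2 _)]
  have h := abs_le.1 (abs_inner_antiderivOp_le (f - constL2 (avgL2 f)) g)
  constructor
  · linarith [mul_le_mul_of_nonneg_left h.2 hθ]
  · linarith [mul_le_mul_of_nonneg_left h.1 hθ]

theorem IsMildSolution.dist_decay (h : IsMildSolution σ u₀ v₀ u v) {θ α : ℝ} (hθ : 0 ≤ θ)
    (hθ2 : θ < 2) (hα : α ≤ θ) (hσ : ∀ᵐ x ∂torusMeasure, RateCondition θ α (σ x)) {t : ℝ}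
    (ht : 0 ≤ t) :
    distEquilibrium (avgL2 u₀ / 2) (u t) (v t) ≤ √((2 + θ) / (2 - θ))
      * distEquilibrium (avgL2 u₀ / 2) u₀ v₀ * Real.exp (-(α / 2) * t) := by
  have h2 : 0 < 2 - θ := by linarith
  have hdecay := h.entropy_decay hθ hα hσ ht
  have hlow := (entropy_bounds hθ (h.avgL2_eq ht) (v t)).1
  have hup := (entropy_bounds hθ (rfl : avgL2 u₀ = avgL2 u₀) v₀).2
  have hR : 0 ≤ √((2 + θ) / (2 - θ)) * distEquilibrium (avgL2 u₀ / 2) u₀ v₀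
      * Real.exp (-(α / 2) * t) := by
    have := distEquilibrium_nonneg (avgL2 u₀ / 2) u₀ v₀
    positivity
  refine le_of_sq_le_sq ?_ hR
  rw [mul_pow, mul_pow, Real.sq_sqrt (by positivity), ← Real.exp_nat_mul]
  have hexp : ((2 : ℕ) : ℝ) * (-(α / 2) * t) = -α * t := by push_cast; ring
  rw [hexp]
  have h3 := hlow.trans (hdecay.trans (mul_le_mul_of_nonneg_right hup (Real.exp_pos _).le))
  have h4 : (2 + θ) / (2 - θ) * distEquilibrium (avgL2 u₀ / 2) u₀ v₀ ^ 2 * Real.exp (-α * t)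
      = ((2 + θ) * distEquilibrium (avgL2 u₀ / 2) u₀ v₀ ^ 2 * Real.exp (-α * t)) / (2 - θ) := by
    ring
  rw [h4, le_div_iff₀ h2]
  linarith

end Dissipation

/-! ### Algebra of the admissible pairs `(θ, α)`. -/

section Rates

/-- The difference of the two sides is a concave quadratic in `s`; its excess over the chord is `θ²
(s - a)(b - s)`. -/
theorem RateCondition.of_endpoints {θ α a b s : ℝ} (hab : a < b) (ha : RateCondition θ α a)
    (hb : RateCondition θ α b) (has : a ≤ s) (hsb : s ≤ b) : RateCondition θ α s := by
  refine ⟨by linarith [ha.1], ?_⟩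
  have h1 := mul_le_mul_of_nonneg_left ha.2 (sub_nonneg.2 hsb)
  have h2 := mul_le_mul_of_nonneg_left hb.2 (sub_nonneg.2 has)
  have h3 : 0 ≤ θ ^ 2 * ((b - a) * ((s - a) * (b - s))) := by
    have := sub_nonneg.2 has
    have := sub_nonneg.2 hsb
    have := (sub_pos.2 hab).le
    positivity
  refine le_of_mul_le_mul_left ?_ (sub_pos.2 hab)
  linear_combination h1 + h2 + h3

theorem rateCondition_self {θ α : ℝ} (hθ : 0 ≤ θ) (hθ2 : θ ≤ 2) (hα : α ≤ θ) :
    RateCondition θ α θ := by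
  refine ⟨by linarith, ?_⟩
  have h : 0 ≤ (2 - θ) * (2 + θ) * (θ - α) ^ 2 :=
    mul_nonneg (mul_nonneg (by linarith) (by linarith)) (sq_nonneg _)
  linear_combination h

theorem sqrt_lt_self_of_two_lt {σ : ℝ} (hσ : 2 < σ) : √(σ ^ 2 - 4) < σ := by
  rw [Real.sqrt_lt' (by linarith)]
  linarith

theorem rate_le_four_div {σ : ℝ} (hσ : 2 < σ) : σ - √(σ ^ 2 - 4) ≤ 4 / σ := by
  have hs := Real.sq_sqrt (show 0 ≤ σ ^ 2 - 4 by nlinarith)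
  have h1 := sqrt_lt_self_of_two_lt hσ
  have h0 := Real.sqrt_nonneg (σ ^ 2 - 4)
  rw [le_div_iff₀ (by linarith)]
  nlinarith

theorem rateCondition_four_div {σ : ℝ} (hσ : 2 < σ) :
    RateCondition (4 / σ) (σ - √(σ ^ 2 - 4)) σ := by
  have hs := Real.sq_sqrt (show 0 ≤ σ ^ 2 - 4 by nlinarith)
  set s := √(σ ^ 2 - 4) with hsdef
  have h0 : 0 ≤ s := Real.sqrt_nonneg _
  have hpos : 0 < σ := by linarith
  -- Since `σ² - s² = 4`, both coefficients are multiples of `s`, and the discriminant vanishes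
  -- exactly.
  have e1 : 4 / σ - (σ - s) = s * (σ - s) / σ := by
    field_simp
    linear_combination hs
  have e2 : 2 * σ - 4 / σ - (σ - s) = s * (σ + s) / σ := by
    field_simp
    linear_combination -hs
  refine ⟨by rw [e2]; positivity, ?_⟩
  rw [mul_assoc, e1, e2]
  refine le_of_eq ?_
  field_simp
  linear_combination s ^ 2 * hs

/-- The parameter `δ = (b - a)/D`, with `D` the denominator of the rate, makes `b` and the rate
polynomial in `a`, `r`, `δ`; the condition at `b` is then an identity modulo `r² = 4 - a²`. -/
theorem exists_rate_eq {a b : ℝ} (ha : 0 < a) (ha2 : a < 2) (hab : a < b) :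
    ∃ δ r : ℝ, 0 < δ ∧ 0 < r ∧ r ^ 2 = 4 - a ^ 2 ∧ b = a + (4 + 2 * r - a ^ 2) * δ ∧
      a * (4 + 2 * √(4 - a ^ 2) - a * b) / (4 + 2 * √(4 - a ^ 2) - a ^ 2) = a - a ^ 2 * δ := by
  have h4 : 0 < 4 - a ^ 2 := by nlinarith
  have hr := Real.sqrt_pos.2 h4
  have hD : 0 < 4 + 2 * √(4 - a ^ 2) - a ^ 2 := by linarith
  refine ⟨(b - a) / (4 + 2 * √(4 - a ^ 2) - a ^ 2), √(4 - a ^ 2), div_pos (by linarith) hD, hr,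
    Real.sq_sqrt h4.le, ?_, ?_⟩
  · rw [mul_div_cancel₀ _ hD.ne']; ring
  · rw [div_eq_iff hD.ne', sub_mul, mul_assoc, div_mul_cancel₀ _ hD.ne']; ring

theorem thetaStar_pos {a b : ℝ} (ha : 0 < a) (hab : a < b) : 0 < thetaStar a b :=
  lt_min ha (div_pos (by norm_num) (ha.trans hab))

theorem thetaStar_lt_two {a b : ℝ} (ha : 0 < a) (hab : a < b) : thetaStar a b < 2 := by
  rcases lt_or_ge a 2 with h | h
  · exact (min_le_left _ _).trans_lt h
  · refine (min_le_right _ _).trans_lt ?_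
    rw [div_lt_iff₀ (ha.trans hab)]
    linarith

theorem rateCondition_star {a b : ℝ} (ha : 0 < a) (hab : a < b) :
    alphaStar a b ≤ thetaStar a b ∧ RateCondition (thetaStar a b) (alphaStar a b) a ∧
      RateCondition (thetaStar a b) (alphaStar a b) b := by
  have hb : 0 < b := ha.trans hab
  have hθ := thetaStar_lt_two ha hab
  by_cases h : a < 4 / b
  · have e : thetaStar a b = a := min_eq_left h.le
    rw [e] at hθ ⊢
    rw [alphaStar, if_pos h]
    obtain ⟨δ, r, hδ, hr, hr2, hb', hα⟩ := exists_rate_eq ha hθ hab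
    rw [hα]
    have hle : a - a ^ 2 * δ ≤ a := by nlinarith [mul_pos (pow_pos ha 2) hδ]
    refine ⟨hle, rateCondition_self ha.le hθ.le hle, by linarith, le_of_eq ?_⟩
    rw [hb']
    linear_combination 4 * a ^ 2 * δ ^ 2 * hr2
  · have hba : 4 / b ≤ a := not_lt.1 h
    have e : thetaStar a b = 4 / b := min_eq_right hba
    rw [e] at hθ ⊢
    rw [alphaStar, if_neg h]
    have hb2 : 2 < b := by
      rw [div_lt_iff₀ hb] at hθ
      linarith
    have hle := rate_le_four_div hb2
    have h1 := rateCondition_self (by positivity) hθ.le hle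
    have h2 := rateCondition_four_div hb2
    -- Here `θ = 4/b` may lie strictly below `a`; the condition holds at `4/b` and at `b`, hence at
    -- `a` between them.
    exact ⟨hle, h1.of_endpoints (hba.trans_lt hab) h2 hba hab.le, h2⟩

theorem ae_norm_le_norm (σ : LInfty) : ∀ᵐ x ∂torusMeasure, ‖σ x‖ ≤ ‖σ‖ := by
  filter_upwards [ae_le_eLpNormEssSup (f := σ) (μ := torusMeasure)] with x hx
  rw [Lp.norm_def, eLpNorm_exponent_top, ← toReal_enorm]
  refine ENNReal.toReal_mono ?_ hx
  rw [← eLpNorm_exponent_top]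
  exact Lp.eLpNorm_ne_top σ

/-- A real essential infimum is meaningful only for a function bounded below almost everywhere;
`‖σ‖` supplies the bound. -/
theorem ae_sigmaMin_le (σ : LInfty) : ∀ᵐ x ∂torusMeasure, sigmaMin σ ≤ σ x := by
  refine ae_essInf_le ⟨-‖σ‖, ?_⟩
  rw [eventually_map]
  filter_upwards [ae_norm_le_norm σ] with x hx
  exact (abs_le.1 hx).1

theorem ae_le_sigmaMax (σ : LInfty) : ∀ᵐ x ∂torusMeasure, σ x ≤ sigmaMax σ := by
  refine ae_le_essSup ⟨‖σ‖, ?_⟩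
  rw [eventually_map]
  filter_upwards [ae_norm_le_norm σ] with x hx
  exact (abs_le.1 hx).2

theorem ae_rateCondition_star {σ : LInfty} (h0 : 0 < sigmaMin σ) (h1 : sigmaMin σ < sigmaMax σ) :
    ∀ᵐ x ∂torusMeasure, RateCondition (thetaStar (sigmaMin σ) (sigmaMax σ))
      (alphaStar (sigmaMin σ) (sigmaMax σ)) (σ x) := by
  obtain ⟨-, hm, hM⟩ := rateCondition_star h0 h1
  filter_upwards [ae_sigmaMin_le σ, ae_le_sigmaMax σ] with x hx1 hx2
  exact hm.of_endpoints h1 hM hx1 hx2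

theorem ae_rateCondition_const {θ α s : ℝ} (h : RateCondition θ α s) :
    ∀ᵐ x ∂torusMeasure, RateCondition θ α ((Lp.const ∞ torusMeasure s : LInfty) x) := by
  filter_upwards [Lp.coeFn_const (α := Torus) (p := ∞) (μ := torusMeasure) s] with x hx
  rw [hx]
  exact h

theorem two_mul_muConst {σ : ℝ} (hσ : 2 < σ) : 2 * muConst σ = σ - √(σ ^ 2 - 4) := by
  have h : √(σ ^ 2 / 4 - 1) = √(σ ^ 2 - 4) / 2 := by
    rw [show σ ^ 2 / 4 - 1 = (σ ^ 2 - 4) / 2 ^ 2 by ring, Real.sqrt_div' _ (by positivity),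
      Real.sqrt_sq (by norm_num)]
  rw [muConst, if_neg (by linarith), h]
  ring

theorem rateCondition_constant {σ : ℝ} (h0 : 0 < σ) (h2 : σ ≠ 2) :
    0 < thetaConst σ ∧ thetaConst σ < 2 ∧ 2 * muConst σ ≤ thetaConst σ ∧
      RateCondition (thetaConst σ) (2 * muConst σ) σ ∧
      CConst σ = √((2 + thetaConst σ) / (2 - thetaConst σ)) := by
  rcases lt_or_gt_of_ne h2 with h | h
  · have hα : 2 * muConst σ = σ := by rw [muConst, if_pos h]; ring
    rw [hα, thetaConst, if_pos h, CConst, if_pos h]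
    exact ⟨h0, h, le_rfl, rateCondition_self h0.le h.le le_rfl, rfl⟩
  · rw [two_mul_muConst h, thetaConst, if_neg h.le.not_gt, CConst, if_neg h.le.not_gt]
    refine ⟨by positivity, ?_, rate_le_four_div h, rateCondition_four_div h, ?_⟩
    · rw [div_lt_iff₀ h0]; linarith
    · congr 1
      have h3 : σ - 2 ≠ 0 := by linarith
      rw [show 2 + 4 / σ = 2 * (σ + 2) / σ by field_simp; ring,
        show 2 - 4 / σ = 2 * (σ - 2) / σ by field_simp; ring]
      field_simp

theorem rateCondition_eps {ε : ℝ} (h0 : 0 < ε) (h1 : ε < 1) :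
    0 < thetaEps ε ∧ thetaEps ε < 2 ∧ 2 * (1 - ε) ≤ thetaEps ε ∧
      RateCondition (thetaEps ε) (2 * (1 - ε)) 2 ∧
      √2 / ε = √((2 + thetaEps ε) / (2 - thetaEps ε)) := by
  have hD : 0 < 2 + ε ^ 2 := by positivity
  have hε : ε ^ 2 < 1 := by nlinarith
  have e1 : thetaEps ε - 2 * (1 - ε) = 2 * ε * ((1 - ε) ^ 2 + 1) / (2 + ε ^ 2) := by
    rw [thetaEps]; field_simp; ring
  have e2 : 2 * 2 - thetaEps ε - 2 * (1 - ε) = 2 * ε * ((1 + ε) ^ 2 + 1) / (2 + ε ^ 2) := by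
    rw [thetaEps]; field_simp; ring
  have e3 : 2 - thetaEps ε = 4 * ε ^ 2 / (2 + ε ^ 2) := by
    rw [thetaEps]; field_simp; ring
  have e4 : 2 + thetaEps ε = 8 / (2 + ε ^ 2) := by
    rw [thetaEps]; field_simp; ring
  refine ⟨?_, ?_, ?_, ⟨?_, ?_⟩, ?_⟩
  · rw [thetaEps]
    have : 0 < 2 - ε ^ 2 := by linarith
    positivity
  · have : 0 < 2 - thetaEps ε := by rw [e3]; positivity
    linarith
  · have : 0 ≤ thetaEps ε - 2 * (1 - ε) := by rw [e1]; positivity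
    linarith
  · rw [e2]; positivity
  · rw [e2, e1]
    have e5 : (thetaEps ε * (2 - 2 * (1 - ε))) ^ 2
        = 16 * ε ^ 2 * (2 - ε ^ 2) ^ 2 / (2 + ε ^ 2) ^ 2 := by
      rw [thetaEps]; field_simp; ring
    have e6 : 4 * (2 * ε * ((1 - ε) ^ 2 + 1) / (2 + ε ^ 2))
        * (2 * ε * ((1 + ε) ^ 2 + 1) / (2 + ε ^ 2))
        = 16 * ε ^ 2 * (4 + ε ^ 4) / (2 + ε ^ 2) ^ 2 := by
      field_simp; ring
    rw [e5, e6]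
    gcongr
    -- What is left is `(2 - ε²)² ≤ 4 + ε⁴`.
    nlinarith
  · have e7 : (2 + thetaEps ε) / (2 - thetaEps ε) = 2 / ε ^ 2 := by
      rw [e3, e4]; field_simp; norm_num
    rw [e7, Real.sqrt_div' _ (by positivity), Real.sqrt_sq h0.le]

end Rates

/-! ### Explicit solutions in the first Fourier mode. -/

section Sharpness

/-- The cosine on the torus. -/
noncomputable def cosTorus : C(Torus, ℝ) := ⟨fun x => (fourier 1 x).re, by fun_prop⟩

/-- The sine on the torus. -/
noncomputable def sinTorus : C(Torus, ℝ) := ⟨fun x => (fourier 1 x).im, by fun_prop⟩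

/-- The cosine as an element of `L²(𝕋)`. -/
noncomputable def cosL2 : L2 := ContinuousMap.toLp 2 torusMeasure ℝ cosTorus

/-- The sine as an element of `L²(𝕋)`. -/
noncomputable def sinL2 : L2 := ContinuousMap.toLp 2 torusMeasure ℝ sinTorus

theorem coeFn_cosL2 : (cosL2 : Torus → ℝ) =ᵐ[torusMeasure] cosTorus :=
  ContinuousMap.coeFn_toLp torusMeasure cosTorus

theorem coeFn_sinL2 : (sinL2 : Torus → ℝ) =ᵐ[torusMeasure] sinTorus :=
  ContinuousMap.coeFn_toLp torusMeasure sinTorus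

theorem fourier_one_sub_coe (x : Torus) (t : ℝ) :
    fourier 1 (x - (t : Torus)) = fourier 1 x * ((cos t : ℂ) - (sin t : ℂ) * Complex.I) := by
  have h := fourier_neg_coe 1 t
  rw [Int.cast_one, one_mul] at h
  rw [← h]
  simp only [fourier_apply]
  rw [← Circle.coe_mul, ← AddCircle.toCircle_add]
  congr 2
  simp [sub_eq_add_neg]

theorem cosTorus_sub (x : Torus) (t : ℝ) :
    cosTorus (x - (t : Torus)) = cos t * cosTorus x + sin t * sinTorus x := by
  simp only [cosTorus, sinTorus, ContinuousMap.coe_mk, fourier_one_sub_coe, Complex.mul_re,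
    Complex.mul_im, Complex.sub_re, Complex.sub_im, Complex.ofReal_re, Complex.ofReal_im,
    Complex.I_re, Complex.I_im]
  ring

theorem sinTorus_sub (x : Torus) (t : ℝ) :
    sinTorus (x - (t : Torus)) = cos t * sinTorus x - sin t * cosTorus x := by
  simp only [cosTorus, sinTorus, ContinuousMap.coe_mk, fourier_one_sub_coe, Complex.mul_re,
    Complex.mul_im, Complex.sub_re, Complex.sub_im, Complex.ofReal_re, Complex.ofReal_im,
    Complex.I_re, Complex.I_im]
  ring

theorem translate_cosL2 (t : ℝ) : translate t cosL2 = cos t • cosL2 + sin t • sinL2 := by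
  refine Lp.ext ?_
  filter_upwards [coeFn_translate t cosL2,
    (measurePreserving_sub_coe t).quasiMeasurePreserving.ae coeFn_cosL2, coeFn_cosL2, coeFn_sinL2,
    Lp.coeFn_add (cos t • cosL2) (sin t • sinL2), Lp.coeFn_smul (cos t) cosL2,
    Lp.coeFn_smul (sin t) sinL2] with x h1 h2 h3 h4 h5 h6 h7
  rw [h1, h2, h5, Pi.add_apply, h6, h7, Pi.smul_apply, Pi.smul_apply, h3, h4, cosTorus_sub]
  rfl

theorem translate_sinL2 (t : ℝ) : translate t sinL2 = cos t • sinL2 - sin t • cosL2 := by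
  refine Lp.ext ?_
  filter_upwards [coeFn_translate t sinL2,
    (measurePreserving_sub_coe t).quasiMeasurePreserving.ae coeFn_sinL2, coeFn_cosL2, coeFn_sinL2,
    Lp.coeFn_sub (cos t • sinL2) (sin t • cosL2), Lp.coeFn_smul (cos t) sinL2,
    Lp.coeFn_smul (sin t) cosL2] with x h1 h2 h3 h4 h5 h6 h7
  rw [h1, h2, h5, Pi.sub_apply, h6, h7, Pi.smul_apply, Pi.smul_apply, h3, h4, sinTorus_sub]
  rfl

theorem avgL2_cosL2 : avgL2 cosL2 = 0 := by
  have h := avgL2_translate π cosL2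
  rw [translate_cosL2, Real.cos_pi, Real.sin_pi, zero_smul, add_zero, avgL2_smul] at h
  linarith

theorem norm_sinL2 : ‖sinL2‖ = ‖cosL2‖ := by
  have h := norm_translate (π / 2) cosL2
  rwa [translate_cosL2, Real.cos_pi_div_two, Real.sin_pi_div_two, zero_smul, zero_add,
    one_smul] at h

theorem norm_cosL2_pos : 0 < ‖cosL2‖ := by
  rw [norm_pos_iff]
  intro h
  have h1 : cosTorus = 0 := by
    refine ContinuousMap.toLp_injective (p := 2) (𝕜 := ℝ) torusMeasure ?_
    rw [map_zero]
    exact h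
  have h2 := DFunLike.congr_fun h1 0
  simp [cosTorus] at h2

theorem freeFlow_cos_sin (t a b : ℝ) :
    freeFlow t (a • cosL2, b • sinL2)
      = ((a * cos t - b * sin t) • cosL2, (a * sin t + b * cos t) • sinL2) := by
  simp only [freeFlow, translate_add, translate_sub, translate_smul, translate_cosL2,
    translate_sinL2, Real.cos_neg, Real.sin_neg]
  refine Prod.ext ?_ ?_ <;> simp only <;> module

theorem const_smul_eq (σ : ℝ) (f : L2) :
    ((Lp.const ∞ torusMeasure σ : LInfty) • f : L2) = σ • f := by
  refine Lp.ext ?_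
  rw [← mulOp_apply]
  filter_upwards [coeFn_mulOp (Lp.const ∞ torusMeasure σ) f, Lp.coeFn_smul σ f,
    Lp.coeFn_const (α := Torus) (p := ∞) (μ := torusMeasure) σ] with x h1 h2 h3
  rw [h1, h2, h3]
  rfl

/-- The ODE makes `freeFlow (t - s) (relaxation w(s))` the `s`-derivative of `freeFlow (t - s)
w(s)`, where `w = (a cos, b sin)`, so Duhamel's formula is the fundamental theorem of calculus. -/
theorem isMildSolution_cos_sin {σ : ℝ} {a b : ℝ → ℝ} (ha : ∀ t, HasDerivAt a (-b t) t)
    (hb : ∀ t, HasDerivAt b (a t - σ * b t) t) :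
    IsMildSolution (Lp.const ∞ torusMeasure σ) (a 0 • cosL2) (b 0 • sinL2)
      (fun t => a t • cosL2) (fun t => b t • sinL2) := by
  have hac : Continuous a := continuous_iff_continuousAt.2 fun t => (ha t).continuousAt
  have hbc : Continuous b := continuous_iff_continuousAt.2 fun t => (hb t).continuousAt
  refine ⟨(hac.smul continuous_const).continuousOn, (hbc.smul continuous_const).continuousOn,
    fun t _ => ?_⟩
  have hrel : ∀ s, relaxation (Lp.const ∞ torusMeasure σ) (a s • cosL2, b s • sinL2)
      = ((0 : ℝ) • cosL2, (-(σ * b s)) • sinL2) := by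
    intro s
    rw [relaxation, const_smul_eq, smul_smul, zero_smul, neg_smul]
  simp only [hrel]
  have hd : ∀ s, HasDerivAt (fun s => freeFlow (t - s) (a s • cosL2, b s • sinL2))
      (freeFlow (t - s) ((0 : ℝ) • cosL2, (-(σ * b s)) • sinL2)) s := by
    intro s
    simp only [freeFlow_cos_sin]
    have hr : HasDerivAt (fun s => t - s) (-1) s := by
      simpa using (hasDerivAt_id s).const_sub t
    have h1 := ((ha s).mul hr.cos).sub ((hb s).mul hr.sin)
    have h2 := ((ha s).mul hr.sin).add ((hb s).mul hr.cos)
    refine ((h1.smul_const cosL2).prodMk (h2.smul_const sinL2)).congr_deriv ?_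
    refine Prod.ext ?_ ?_
    · simp only
      congr 1
      ring
    · simp only
      congr 1
      ring
  have hcont : Continuous fun s => freeFlow (t - s) ((0 : ℝ) • cosL2, (-(σ * b s)) • sinL2) :=
    continuous_freeFlow_comp (by fun_prop)
      (continuous_const.prodMk ((continuous_const.mul hbc).neg.smul continuous_const))
  rw [intervalIntegral.integral_eq_sub_of_hasDerivAt (fun s _ => hd s)
    (hcont.intervalIntegrable _ _)]
  simp only [sub_self, sub_zero]
  rw [add_sub_cancel, freeFlow_cos_sin]
  simp

theorem exists_mildSolution_lower_bound {σ μ κ : ℝ} {a b : ℝ → ℝ} (hκ : 0 < κ)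
    (ha : ∀ t, HasDerivAt a (-b t) t) (hb : ∀ t, HasDerivAt b (a t - σ * b t) t)
    (hlow : ∀ t, κ * Real.exp (-μ * t) ^ 2 ≤ a t ^ 2 + b t ^ 2) :
    ∃ (u₀ v₀ : L2) (u v : ℝ → L2),
      IsMildSolution (Lp.const ∞ torusMeasure σ) u₀ v₀ u v ∧
      ∃ c : ℝ, 0 < c ∧ ∀ t : ℝ, 0 ≤ t →
        c * Real.exp (-μ * t) ≤ distEquilibrium (avgL2 u₀ / 2) (u t) (v t) := by
  refine ⟨_, _, _, _, isMildSolution_cos_sin ha hb, √(κ / 2) * ‖cosL2‖,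
    mul_pos (Real.sqrt_pos.2 (by positivity)) norm_cosL2_pos, fun t _ => ?_⟩
  refine le_of_sq_le_sq ?_ (distEquilibrium_nonneg _ _ _)
  have h0 : constL2 0 = 0 := map_zero (Lp.const 2 torusMeasure)
  rw [avgL2_smul, avgL2_cosL2, mul_zero, distEquilibrium_sq, h0, sub_zero, norm_smul, norm_smul,
    norm_sinL2, mul_pow, mul_pow, mul_pow, mul_pow, Real.sq_sqrt (by positivity),
    Real.norm_eq_abs, Real.norm_eq_abs, sq_abs, sq_abs]
  have h := mul_le_mul_of_nonneg_right (hlow t) (sq_nonneg ‖cosL2‖)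
  linarith

theorem hasDerivAt_exp_neg_mul (μ t : ℝ) :
    HasDerivAt (fun t => Real.exp (-μ * t)) (-μ * Real.exp (-μ * t)) t := by
  simpa [mul_comm] using ((hasDerivAt_id t).const_mul (-μ)).exp

theorem exists_sharp_mildSolution {σ : ℝ} (h0 : 0 < σ) (h2 : σ ≠ 2) :
    ∃ (u₀ v₀ : L2) (u v : ℝ → L2),
      IsMildSolution (Lp.const ∞ torusMeasure σ) u₀ v₀ u v ∧
      ∃ c : ℝ, 0 < c ∧ ∀ t : ℝ, 0 ≤ t →
        c * Real.exp (-muConst σ * t) ≤ distEquilibrium (avgL2 u₀ / 2) (u t) (v t) := by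
  rcases lt_or_gt_of_ne h2 with h | h
  · rw [show muConst σ = σ / 2 from if_pos h]
    have hω : 0 < 1 - σ ^ 2 / 4 := by nlinarith
    obtain ⟨ω, hω0, hω2⟩ : ∃ ω : ℝ, 0 < ω ∧ ω ^ 2 = 1 - σ ^ 2 / 4 :=
      ⟨√(1 - σ ^ 2 / 4), Real.sqrt_pos.2 hω, Real.sq_sqrt hω.le⟩
    have hcos : ∀ t, HasDerivAt (fun t => cos (ω * t)) (-(ω * sin (ω * t))) t := fun t => by
      simpa [mul_comm] using ((hasDerivAt_id t).const_mul ω).cos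
    have hsin : ∀ t, HasDerivAt (fun t => sin (ω * t)) (ω * cos (ω * t)) t := fun t => by
      simpa [mul_comm] using ((hasDerivAt_id t).const_mul ω).sin
    -- The damped oscillator `a'' + σ a' + a = 0` with complex roots `-σ/2 ± iω`, and `b = -a'`.
    refine exists_mildSolution_lower_bound (κ := ω ^ 2 / 3)
      (a := fun t => Real.exp (-(σ / 2) * t) * cos (ω * t))
      (b := fun t => Real.exp (-(σ / 2) * t) * (σ / 2 * cos (ω * t) + ω * sin (ω * t)))
      (by positivity) (fun t => ?_) (fun t => ?_) (fun t => ?_)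
    · refine ((hasDerivAt_exp_neg_mul (σ / 2) t).mul (hcos t)).congr_deriv ?_
      ring
    · refine ((hasDerivAt_exp_neg_mul (σ / 2) t).mul
        (((hcos t).const_mul (σ / 2)).add ((hsin t).const_mul ω))).congr_deriv ?_
      simp only [Pi.add_apply]
      linear_combination Real.exp (-(σ / 2) * t) * cos (ω * t) * hω2
    · have hcs := Real.sin_sq_add_cos_sq (ω * t)
      set C := cos (ω * t)
      set S := sin (ω * t)
      -- With `X = σ/2 · C + ω S`: `ω² S² ≤ 2X² + 2C²` and `ω² C² ≤ C²` add up to `ω² ≤ 2X² + 3C²`,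
      -- whence the constant `1/3`.
      have key : ω ^ 2 / 3 ≤ C ^ 2 + (σ / 2 * C + ω * S) ^ 2 := by
        have h1 : ω ^ 2 * S ^ 2 ≤ 2 * (σ / 2 * C + ω * S) ^ 2 + 2 * C ^ 2 := by
          have h3 : 0 ≤ (1 - σ ^ 2 / 4) * C ^ 2 := by positivity
          nlinarith [sq_nonneg (σ * C + ω * S)]
        have h4 : ω ^ 2 * C ^ 2 ≤ C ^ 2 :=
          mul_le_of_le_one_left (sq_nonneg _) (by nlinarith)
        nlinarith [sq_nonneg (σ / 2 * C + ω * S)]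
      have h5 := mul_le_mul_of_nonneg_left key (sq_nonneg (Real.exp (-(σ / 2) * t)))
      linear_combination h5
  -- For `σ > 2` the roots are real and `-μ` is the slower one, so a pure exponential suffices.
  · have hμ : muConst σ ^ 2 - σ * muConst σ + 1 = 0 := by
      have hs := Real.sq_sqrt (show 0 ≤ σ ^ 2 - 4 by nlinarith)
      have e := two_mul_muConst h
      have e' : muConst σ = (σ - √(σ ^ 2 - 4)) / 2 := by linarith
      rw [e']
      linear_combination hs / 4
    refine exists_mildSolution_lower_bound (κ := 1)
      (a := fun t => Real.exp (-muConst σ * t))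
      (b := fun t => muConst σ * Real.exp (-muConst σ * t)) one_pos (fun t => ?_) (fun t => ?_)
      (fun t => ?_)
    · exact (hasDerivAt_exp_neg_mul _ t).congr_deriv (by ring)
    · refine ((hasDerivAt_exp_neg_mul _ t).const_mul (muConst σ)).congr_deriv ?_
      linear_combination (-Real.exp (-muConst σ * t)) * hμ
    · nlinarith [sq_nonneg (muConst σ * Real.exp (-muConst σ * t))]

end Sharpness

end GoldsteinTaylor

/-! ### The three regimes, each by the general decay estimates with its own `θ` and `α`. -/

theorem theorem1 :
    -- constant relaxation coefficient, `σ ≠ 2`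
    (∀ σ : ℝ, 0 < σ → σ ≠ 2 →
      (∀ (u₀ v₀ : GoldsteinTaylor.L2) (u v : ℝ → GoldsteinTaylor.L2),
        GoldsteinTaylor.IsMildSolution (Lp.const ∞ GoldsteinTaylor.torusMeasure σ) u₀ v₀ u v →
        ∀ t : ℝ, 0 ≤ t →
          GoldsteinTaylor.entropy (GoldsteinTaylor.thetaConst σ)
              (u t - GoldsteinTaylor.constL2 (GoldsteinTaylor.avgL2 u₀)) (v t)
            ≤ GoldsteinTaylor.entropy (GoldsteinTaylor.thetaConst σ)
                (u₀ - GoldsteinTaylor.constL2 (GoldsteinTaylor.avgL2 u₀)) v₀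
              * Real.exp (-2 * GoldsteinTaylor.muConst σ * t) ∧
          GoldsteinTaylor.distEquilibrium (GoldsteinTaylor.avgL2 u₀ / 2) (u t) (v t)
            ≤ GoldsteinTaylor.CConst σ
              * GoldsteinTaylor.distEquilibrium (GoldsteinTaylor.avgL2 u₀ / 2) u₀ v₀
              * Real.exp (-GoldsteinTaylor.muConst σ * t)) ∧
      -- sharpness: some solution off equilibrium decays no faster than `exp (-μ(σ) t)`
      (∃ (u₀ v₀ : GoldsteinTaylor.L2) (u v : ℝ → GoldsteinTaylor.L2),
        GoldsteinTaylor.IsMildSolution (Lp.const ∞ GoldsteinTaylor.torusMeasure σ) u₀ v₀ u v ∧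
        ∃ c : ℝ, 0 < c ∧ ∀ t : ℝ, 0 ≤ t →
          c * Real.exp (-GoldsteinTaylor.muConst σ * t)
            ≤ GoldsteinTaylor.distEquilibrium (GoldsteinTaylor.avgL2 u₀ / 2) (u t) (v t))) ∧
    -- constant relaxation coefficient, `σ = 2`
    (∀ (u₀ v₀ : GoldsteinTaylor.L2) (u v : ℝ → GoldsteinTaylor.L2),
      GoldsteinTaylor.IsMildSolution (Lp.const ∞ GoldsteinTaylor.torusMeasure (2 : ℝ)) u₀ v₀ u v →
      ∀ ε : ℝ, 0 < ε → ε < 1 → ∀ t : ℝ, 0 ≤ t →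
        GoldsteinTaylor.entropy (GoldsteinTaylor.thetaEps ε)
            (u t - GoldsteinTaylor.constL2 (GoldsteinTaylor.avgL2 u₀)) (v t)
          ≤ GoldsteinTaylor.entropy (GoldsteinTaylor.thetaEps ε)
              (u₀ - GoldsteinTaylor.constL2 (GoldsteinTaylor.avgL2 u₀)) v₀
            * Real.exp (-2 * (1 - ε) * t) ∧
        GoldsteinTaylor.distEquilibrium (GoldsteinTaylor.avgL2 u₀ / 2) (u t) (v t)
          ≤ √2 / ε
            * GoldsteinTaylor.distEquilibrium (GoldsteinTaylor.avgL2 u₀ / 2) u₀ v₀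
            * Real.exp (-(1 - ε) * t)) ∧
    -- non-constant relaxation coefficient
    (∀ σ : GoldsteinTaylor.LInfty,
      0 < GoldsteinTaylor.sigmaMin σ →
      GoldsteinTaylor.sigmaMin σ < GoldsteinTaylor.sigmaMax σ →
      ∀ (u₀ v₀ : GoldsteinTaylor.L2) (u v : ℝ → GoldsteinTaylor.L2),
        GoldsteinTaylor.IsMildSolution σ u₀ v₀ u v →
        ∀ t : ℝ, 0 ≤ t →
          GoldsteinTaylor.entropy
              (GoldsteinTaylor.thetaStar (GoldsteinTaylor.sigmaMin σ) (GoldsteinTaylor.sigmaMax σ))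
              (u t - GoldsteinTaylor.constL2 (GoldsteinTaylor.avgL2 u₀)) (v t)
            ≤ GoldsteinTaylor.entropy
                (GoldsteinTaylor.thetaStar
                  (GoldsteinTaylor.sigmaMin σ) (GoldsteinTaylor.sigmaMax σ))
                (u₀ - GoldsteinTaylor.constL2 (GoldsteinTaylor.avgL2 u₀)) v₀
              * Real.exp (-GoldsteinTaylor.alphaStar
                  (GoldsteinTaylor.sigmaMin σ) (GoldsteinTaylor.sigmaMax σ) * t) ∧
          GoldsteinTaylor.distEquilibrium (GoldsteinTaylor.avgL2 u₀ / 2) (u t) (v t)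
            ≤ √((2 + GoldsteinTaylor.thetaStar
                    (GoldsteinTaylor.sigmaMin σ) (GoldsteinTaylor.sigmaMax σ))
                / (2 - GoldsteinTaylor.thetaStar
                    (GoldsteinTaylor.sigmaMin σ) (GoldsteinTaylor.sigmaMax σ)))
              * GoldsteinTaylor.distEquilibrium (GoldsteinTaylor.avgL2 u₀ / 2) u₀ v₀
              * Real.exp (-(GoldsteinTaylor.alphaStar
                  (GoldsteinTaylor.sigmaMin σ) (GoldsteinTaylor.sigmaMax σ) / 2) * t)) := by
  refine ⟨fun σ h0 h2 => ⟨fun u₀ v₀ u v h t ht => ?_,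
    GoldsteinTaylor.exists_sharp_mildSolution h0 h2⟩, fun u₀ v₀ u v h ε h0 h1 t ht => ?_,
    fun σ h0 h1 u₀ v₀ u v h t ht => ?_⟩
  · obtain ⟨hθ, hθ2, hα, hr, hC⟩ := GoldsteinTaylor.rateCondition_constant h0 h2
    have hσ := GoldsteinTaylor.ae_rateCondition_const hr
    have hE := h.entropy_decay hθ.le hα hσ ht
    have hD := h.dist_decay hθ.le hθ2 hα hσ ht
    rw [← neg_mul] at hE
    rw [mul_div_cancel_left₀ _ two_ne_zero, ← hC] at hD
    exact ⟨hE, hD⟩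
  · obtain ⟨hθ, hθ2, hα, hr, hC⟩ := GoldsteinTaylor.rateCondition_eps h0 h1
    have hσ := GoldsteinTaylor.ae_rateCondition_const hr
    have hE := h.entropy_decay hθ.le hα hσ ht
    have hD := h.dist_decay hθ.le hθ2 hα hσ ht
    rw [← neg_mul] at hE
    rw [mul_div_cancel_left₀ _ two_ne_zero, ← hC] at hD
    exact ⟨hE, hD⟩
  · have hθ := GoldsteinTaylor.thetaStar_pos h0 h1
    have hα := (GoldsteinTaylor.rateCondition_star h0 h1).1
    have hσ := GoldsteinTaylor.ae_rateCondition_star h0 h1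
    exact ⟨h.entropy_decay hθ.le hα hσ ht,
      h.dist_decay hθ.le (GoldsteinTaylor.thetaStar_lt_two h0 h1) hα hσ ht⟩
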